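/- Let $p\ne 1$ be an integer and let $\hat I=(-\infty,-2)$ if $p>1$ is odd, $\hat I=(0,+\infty)$ if $p<1$ is odd, and $\hat I=(-\infty,-2)\cup(0,+\infty)$ if $p$ is even. Let $\beta$ be a real number with $\beta\notin\mathbf Z_{\ge 0}$. Powers are read as follows: $y^\beta$ is the usual power for $y>0$, and $y^\beta=\sigma|y|^\beta$ for $y<0$, where $\sigma\neq 0$ is an arbitrary fixed real number (a chosen value of $(-1)^\beta$). For an interval $E\subseteq[0,\pi]$, an integer $k\ge 0$ and $\rho\in\hat I$ put $$\mathcal C_k^E(\rho)=\int_E\cos(k\theta)(1+\rho-\cos\theta)^\beta d\theta,\quad \mathcal S_k^E(\rho)=\int_E\sin(k\theta)(1+\rho-\cos\theta)^\beta d\theta,\quad \mathcal D_k^E(\rho)=\int_E\theta\sin(k\theta)(1+\rho-\cos\theta)^\beta d\theta .$$ An ordered set $(f_0,\dots,f_{N-1})$ of analytic functions on $\hat I$ is an ECT-system on $\hat I$ if, for every $k=1,\dots,N$, every nontrivial linear combination of $f_0,\dots,f_{k-1}$ has at most $k-1$ zeros on $\hat I$ counted with multiplicity (in particular it does not vanish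 identically). Let $\vartheta\in[0,\pi]$, $J_1=[0,\vartheta]$ and $J_2=[\vartheta,\pi]$. Then the following hold. (i) For every integer $n>1$, the ordered set $$\left(\mathcal C_0^{J_1},\dots,\mathcal C_n^{J_1},\ \mathcal S_n^{J_1},\dots,\mathcal S_1^{J_1},\ \mathcal C_0^{J_2},\dots,\mathcal C_n^{J_2}\right)$$ is an ECT-system on $\hat I$. (ii) For all integers $n>m\ge 1$, the ordered set $$\left(\mathcal C_0^{J_1},\ \mathcal C_1^{J_1},\mathcal S_1^{J_1},\mathcal D_1^{J_1},\dots,\mathcal C_{m-1}^{J_1},\mathcal S_{m-1}^{J_1},\mathcal D_{m-1}^{J_1},\ \mathcal C_m^{J_1},\dots,\mathcal C_n^{J_1},\ \mathcal S_n^{J_1},\dots,\mathcal S_m^{J_1},\ \mathcal C_0^{J_2},\mathcal C_1^{J_2},\dots,\mathcal C_n^{J_2}\right)$$ is an ECT-system on $\hat I$. (iii) For all integers $n>m\ge 1$, the ordered set $$\begin{aligned}\big(&\mathcal C_0^{J_1},\ \mathcal C_1^{J_1},\mathcal S_1^{J_1},\mathcal D_1^{J_1},\dots,\mathcal C_{m-1}^{J_1},\mathcal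 S_{m-1}^{J_1},\mathcal D_{m-1}^{J_1},\ \mathcal C_m^{J_1},\dots,\mathcal C_n^{J_1},\ \mathcal S_n^{J_1},\dots,\mathcal S_m^{J_1},\\ &\mathcal C_0^{J_2},\ \mathcal C_1^{J_2},\mathcal S_1^{J_2},\mathcal D_1^{J_2},\dots,\mathcal C_{m-1}^{J_2},\mathcal S_{m-1}^{J_2},\mathcal D_{m-1}^{J_2},\ \mathcal C_m^{J_2},\dots,\mathcal C_n^{J_2}\big)\end{aligned}$$ is an ECT-system on $\hat I$. Here, when $\vartheta=0$ (resp. $\vartheta=\pi$), the functions with superscript $J_1$ (resp. $J_2$) are removed from the ordered sets. -/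

import Mathlib

noncomputable section

/-- The real power `y ^ β` for `y ≠ 0`. For `y > 0` it is the usual one. For `y < 0` it is
`σ * |y| ^ β`, where the real number `σ` is the chosen nonzero value of `(-1) ^ β`: for instance
`σ = (-1) ^ β` if `β` is an integer, and `σ = ±1` if `β` is a fraction with odd denominator. -/
def branchPow (σ β y : ℝ) : ℝ := if 0 < y then y ^ β else σ * |y| ^ β

/-- `C_k^E(ρ, β) = ∫_E cos (k θ) (1 + ρ - cos θ)^β dθ`. -/
def cosInt (σ β : ℝ) (E : Set ℝ) (k : ℕ) (ρ : ℝ) : ℝ :=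
  ∫ θ in E, Real.cos (k * θ) * branchPow σ β (1 + ρ - Real.cos θ)

/-- `S_k^E(ρ, β) = ∫_E sin (k θ) (1 + ρ - cos θ)^β dθ`. -/
def sinInt (σ β : ℝ) (E : Set ℝ) (k : ℕ) (ρ : ℝ) : ℝ :=
  ∫ θ in E, Real.sin (k * θ) * branchPow σ β (1 + ρ - Real.cos θ)

/-- `D_k^E(ρ, β) = ∫_E θ sin (k θ) (1 + ρ - cos θ)^β dθ`. -/
def thetaSinInt (σ β : ℝ) (E : Set ℝ) (k : ℕ) (ρ : ℝ) : ℝ :=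
  ∫ θ in E, θ * Real.sin (k * θ) * branchPow σ β (1 + ρ - Real.cos θ)

/-- The domain of `ρ`, determined by the integer `p ≠ 1`. -/
def rhoDomain (p : ℤ) : Set ℝ :=
  if Even p then Set.Iio (-2) ∪ Set.Ioi 0
  else if 1 < p then Set.Iio (-2)
  else Set.Ioi 0

/-- `(f₀, …, f_{N-1})` is an extended complete Chebyshev system on `I`: the functions are analytic
on `I`, and for `k = 1, …, N` every nontrivial linear combination of `f₀, …, f_{k-1}` has at most
`k - 1` zeros on `I` counted with multiplicity. The multiplicity of a zero is the order of vanishing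
(`0` at a point that is not a zero, and `⊤` where the function vanishes identically nearby, so a
combination that vanishes identically is not allowed). -/
def IsECTSystem (f : List (ℝ → ℝ)) (I : Set ℝ) : Prop :=
  (∀ g ∈ f, AnalyticOnNhd ℝ g I) ∧
  ∀ (k : ℕ) (hk : k ≤ f.length), 1 ≤ k → ∀ a : Fin k → ℝ, a ≠ 0 →
    ∀ Z : Finset ℝ, (Z : Set ℝ) ⊆ I →
      ∑ x ∈ Z, analyticOrderAt (fun t => ∑ i : Fin k, a i * f.get (Fin.castLE hk i) t) x
        ≤ ((k - 1 : ℕ) : ℕ∞)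

/-- `C_a, C_{a+1}, …, C_b` over `E`. -/
def cosList (σ β : ℝ) (E : Set ℝ) (a b : ℕ) : List (ℝ → ℝ) :=
  (List.Ico a (b + 1)).map (cosInt σ β E)

/-- `S_b, S_{b-1}, …, S_a` over `E`, in decreasing order of the index. -/
def sinListRev (σ β : ℝ) (E : Set ℝ) (a b : ℕ) : List (ℝ → ℝ) :=
  ((List.Ico a (b + 1)).map (sinInt σ β E)).reverse

/-- `C_1, S_1, D_1, …, C_{m-1}, S_{m-1}, D_{m-1}` over `E`. -/
def tripleList (σ β : ℝ) (E : Set ℝ) (m : ℕ) : List (ℝ → ℝ) :=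
  (List.Ico 1 m).flatMap fun k => [cosInt σ β E k, sinInt σ β E k, thetaSinInt σ β E k]

/-- The concatenation of a list `L₁` of integrals over `[0, ϑ]` and a list `L₂` of integrals over
`[ϑ, π]`, where `L₁` is removed if `ϑ = 0` and `L₂` is removed if `ϑ = π`. -/
def joinAt (ϑ : ℝ) (L₁ L₂ : List (ℝ → ℝ)) : List (ℝ → ℝ) :=
  (if ϑ = 0 then [] else L₁) ++ (if ϑ = Real.pi then [] else L₂)

/-- `(C_0, …, C_n, S_n, …, S_1)` over `[0, ϑ]`, then `(C_0, …, C_n)` over `[ϑ, π]`. -/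
def familyOne (σ β ϑ : ℝ) (n : ℕ) : List (ℝ → ℝ) :=
  joinAt ϑ
    (cosList σ β (Set.Icc 0 ϑ) 0 n ++ sinListRev σ β (Set.Icc 0 ϑ) 1 n)
    (cosList σ β (Set.Icc ϑ Real.pi) 0 n)

/-- `(C_0, C_1, S_1, D_1, …, C_{m-1}, S_{m-1}, D_{m-1}, C_m, …, C_n, S_n, …, S_m)` over `[0, ϑ]`,
then `(C_0, …, C_n)` over `[ϑ, π]`. -/
def familyTwo (σ β ϑ : ℝ) (m n : ℕ) : List (ℝ → ℝ) :=
  joinAt ϑ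
    (cosInt σ β (Set.Icc 0 ϑ) 0 :: tripleList σ β (Set.Icc 0 ϑ) m
      ++ cosList σ β (Set.Icc 0 ϑ) m n ++ sinListRev σ β (Set.Icc 0 ϑ) m n)
    (cosList σ β (Set.Icc ϑ Real.pi) 0 n)

/-- `(C_0, C_1, S_1, D_1, …, C_{m-1}, S_{m-1}, D_{m-1}, C_m, …, C_n, S_n, …, S_m)` over `[0, ϑ]`,
then `(C_0, C_1, S_1, D_1, …, C_{m-1}, S_{m-1}, D_{m-1}, C_m, …, C_n)` over `[ϑ, π]`. -/
def familyThree (σ β ϑ : ℝ) (m n : ℕ) : List (ℝ → ℝ) :=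
  joinAt ϑ
    (cosInt σ β (Set.Icc 0 ϑ) 0 :: tripleList σ β (Set.Icc 0 ϑ) m
      ++ cosList σ β (Set.Icc 0 ϑ) m n ++ sinListRev σ β (Set.Icc 0 ϑ) m n)
    (cosInt σ β (Set.Icc ϑ Real.pi) 0 :: tripleList σ β (Set.Icc ϑ Real.pi) m
      ++ cosList σ β (Set.Icc ϑ Real.pi) m n)

end

/-! Put y = 1/(1+ρ). Since 1 + ρ - cos θ = (1+ρ)(1 - y cos θ), a combination of the integrals is, up
to a factor that is analytic and nonzero near each point, F(y) = ∫ G(θ) (1 - y cos θ)^β dθ over [0,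
π], where G is the same combination of the cut-off trigonometric functions. The whole ρ-domain goes
injectively into (-1, 1). Two counts then suffice.

First, F has at most as many zeros, with multiplicity, as G has sign changes (`zerosLE_powInt`). If
G changes sign at t and a = cos t, the derivative of (1 - a y)^(-β) F is a nonvanishing multiple of
an integral of the same kind, with exponent β - 1 and with G multiplied by a - cos θ. This removes
the sign change, and Rolle's theorem costs one zero. The factors β, β - 1, … never vanish because β
is not a nonnegative integer. With no sign change left, the integral has no zero.

Second, a nontrivial combination G of the first k functions has at most k - 1 sign changes
(`SignRegular`). On one interval it even has fewer than k zeros: an operator built from k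
derivatives D = d/d cos θ and from multiplications by powers of sin θ annihilates these k functions,
and each D loses at most one zero, by Rolle. The operators come from the identity D^r sin^(2r+1)
D^(r+1) = -∂ ∏ (∂² + i²), with i from 1 to r and ∂ = d/dθ (`rodriguesOp_zero`, `rodriguesOp_succ`):
the left side counts zeros, the right side shows the kernel. Linear independence excludes the zero
combination. For two intervals, with N functions on the first one and k > N, the counts N - 1 and k
- N - 1, plus one possible change at ϑ, add up to k - 1 (`IsCT.signRegular_append`). -/

noncomputable section

namespace TrigECT

open Real Set MeasureTheory
open scoped ContDiff

/-! ### Operator identities in an abstract ring -/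

section Algebra

variable {R : Type*} [Ring R] {S V X D : R}

/-- The letters model multiplication by sin θ, 1/sin θ and cos θ, and D = d/d cos θ. Thus `S * D` is
-d/dθ, and `hDS` is the product rule with d sin θ/d cos θ = -cos θ/sin θ. -/
theorem ladder_sq (hSV : S * V = 1) (hSX : S * X = X * S) (hDS : D * S = S * D - X * V) :
    (S * D) ^ 2 = S ^ 2 * D ^ 2 - X * D := by
  rw [pow_two, mul_assoc, ← mul_assoc D, hDS, sub_mul, mul_sub, mul_assoc S D, ← mul_assoc S S,
    mul_assoc X, ← mul_assoc S X, hSX, mul_assoc X S, ← mul_assoc S V, hSV, one_mul, pow_two,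
    pow_two]

variable [Algebra ℝ R]

theorem ladder_mul_pow (hSV : S * V = 1) (hVS : V * S = 1) (hSX : S * X = X * S)
    (hDS : D * S = S * D - X * V) (j : ℕ) :
    D * S ^ (j + 2) = S ^ (j + 2) * D - ((j : ℝ) + 2) • (X * S ^ j) := by
  have hcomm : Commute S X := hSX
  induction j with
  | zero =>
    have : D * S ^ 2 = D * S * S := by rw [pow_two, mul_assoc]
    rw [zero_add, this, hDS, sub_mul, mul_assoc S, hDS, mul_assoc X,
      hVS, mul_sub, ← mul_assoc S X, hSX, mul_assoc X, hSV, pow_two, mul_assoc]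
    simp only [mul_one, pow_zero, Nat.cast_zero, zero_add, two_smul]
    abel
  | succ j ih =>
    have h1 : D * S ^ (j + 1 + 2) = D * S ^ (j + 2) * S := by
      rw [mul_assoc, ← pow_succ]
    have h2 : S ^ (j + 2) * (S * D - X * V) = S ^ (j + 1 + 2) * D - X * S ^ (j + 1) := by
      rw [mul_sub, ← mul_assoc, ← pow_succ, ← mul_assoc, (hcomm.pow_left _).eq, mul_assoc X,
        pow_succ _ (j + 1), mul_assoc _ S, hSV, mul_one]
    rw [h1, ih, sub_mul, mul_assoc, hDS, h2, smul_mul_assoc, mul_assoc, ← pow_succ]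
    push_cast
    module

/-- Here `(S * D) ^ 2` is Chebyshev's operator. Moving one more D past it raises the first-order
coefficient by 2 and the constant by 2k + 1, which sums to k². -/
theorem ladder_pow_mul_sq (hSV : S * V = 1) (hVS : V * S = 1) (hSX : S * X = X * S)
    (hDX : D * X = X * D + 1) (hDS : D * S = S * D - X * V) (k : ℕ) :
    D ^ k * (S * D) ^ 2 = (S ^ 2 * D ^ 2 - (2 * (k : ℝ) + 1) • (X * D)
      - ((k : ℝ) ^ 2) • (1 : R)) * D ^ k := by
  induction k with
  | zero => rw [ladder_sq hSV hSX hDS]; simp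
  | succ k ih =>
    have h1 : D * (S ^ 2 * D ^ 2) = (S ^ 2 * D ^ 2 - (2 : ℝ) • (X * D)) * D := by
      have := ladder_mul_pow hSV hVS hSX hDS 0
      simp only [zero_add, Nat.cast_zero, pow_zero, mul_one] at this
      rw [← mul_assoc, this, sub_mul, sub_mul]
      simp only [smul_mul_assoc, pow_two, mul_assoc]
    have h2 : D * (X * D) = (X * D + 1) * D := by
      rw [← mul_assoc, hDX]
    rw [pow_succ', mul_assoc, ih, ← mul_assoc, ← mul_assoc]
    congr 1
    rw [mul_sub, mul_sub, mul_smul_comm, mul_smul_comm, h1, h2]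
    simp only [sub_mul, add_mul, smul_mul_assoc, one_mul, mul_one]
    push_cast
    module

/-- Both sides equal S^(2k+1) (S²D² - (2k+3) X D) D^(k+1): on the left by differentiating the weight
S^(2k+3), on the right because the added (k+1)² cancels the constant in `ladder_pow_mul_sq`. -/
theorem ladder_rodrigues (hSV : S * V = 1) (hVS : V * S = 1) (hSX : S * X = X * S)
    (hDX : D * X = X * D + 1) (hDS : D * S = S * D - X * V) (k : ℕ) :
    D * S ^ (2 * k + 3) * D ^ (k + 2) =
      S ^ (2 * k + 1) * D ^ (k + 1) * ((S * D) ^ 2 + (((k + 1 : ℕ) : ℝ) ^ 2) • (1 : R)) := by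
  have hcomm : Commute S X := hSX
  have h0 : D ^ (k + 1) * ((S * D) ^ 2 + (((k + 1 : ℕ) : ℝ) ^ 2) • (1 : R)) =
      (S ^ 2 * D ^ 2 - (2 * ((k + 1 : ℕ) : ℝ) + 1) • (X * D)) * D ^ (k + 1) := by
    rw [mul_add, ladder_pow_mul_sq hSV hVS hSX hDX hDS]
    simp only [sub_mul, smul_mul_assoc, mul_smul_comm, one_mul, mul_one]
    abel
  have h1 : S ^ (2 * k + 1) * (S ^ 2 * D ^ 2 * D ^ (k + 1))
      = S ^ (2 * k + 1 + 2) * D * D ^ (k + 2) := by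
    rw [← mul_assoc, ← mul_assoc, ← pow_add, mul_assoc, mul_assoc, ← pow_add, ← pow_succ',
      show 2 + (k + 1) = k + 2 + 1 by ring]
  have h2 : S ^ (2 * k + 1) * (X * D * D ^ (k + 1)) = X * S ^ (2 * k + 1) * D ^ (k + 2) := by
    rw [mul_assoc X, ← mul_assoc, (hcomm.pow_left _).eq, ← pow_succ']
  rw [mul_assoc (S ^ (2 * k + 1)), h0, ladder_mul_pow hSV hVS hSX hDS (2 * k + 1)]
  simp only [sub_mul, mul_sub, smul_mul_assoc, mul_smul_comm, h1, h2]
  push_cast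
  module

end Algebra

/-! ### Differential operators on smooth functions on (0, π) -/

/-- Smooth functions on `(0, π)`, extended by zero. -/
def smoothFun : Submodule ℝ (ℝ → ℝ) where
  carrier := {f | ContDiffOn ℝ ∞ f (Ioo 0 π) ∧ ∀ θ ∉ Ioo 0 π, f θ = 0}
  add_mem' := fun {f g} hf hg =>
    ⟨hf.1.add hg.1, fun θ hθ => by simp [hf.2 θ hθ, hg.2 θ hθ]⟩
  zero_mem' := ⟨contDiffOn_const, fun _ _ => rfl⟩
  smul_mem' := fun c f hf => ⟨contDiffOn_const.smul hf.1, fun θ hθ => by simp [hf.2 θ hθ]⟩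

theorem smoothFun_ext {f g : smoothFun} (h : ∀ θ ∈ Ioo 0 π, f.1 θ = g.1 θ) : f = g := by
  ext θ
  by_cases hθ : θ ∈ Ioo 0 π
  · exact h θ hθ
  · rw [f.2.2 θ hθ, g.2.2 θ hθ]

theorem smoothFun_differentiableAt (f : smoothFun) {θ : ℝ} (hθ : θ ∈ Ioo 0 π) :
    DifferentiableAt ℝ f.1 θ :=
  (f.2.1.differentiableOn (by simp)).differentiableAt (isOpen_Ioo.mem_nhds hθ)

/-- Restriction of a function that is smooth on `(0, π)`. -/
def res (f : ℝ → ℝ) (hf : ContDiffOn ℝ ∞ f (Ioo 0 π)) : smoothFun :=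
  ⟨(Ioo 0 π).indicator f, hf.congr fun _ hθ => indicator_of_mem hθ f,
    fun _ hθ => indicator_of_notMem hθ f⟩

theorem res_apply {f : ℝ → ℝ} (hf : ContDiffOn ℝ ∞ f (Ioo 0 π)) {θ : ℝ} (hθ : θ ∈ Ioo 0 π) :
    (res f hf).1 θ = f θ := indicator_of_mem hθ f

theorem deriv_res {f : ℝ → ℝ} (hf : ContDiffOn ℝ ∞ f (Ioo 0 π)) {θ : ℝ} (hθ : θ ∈ Ioo 0 π) :
    deriv (res f hf).1 θ = deriv f θ :=
  Filter.EventuallyEq.deriv_eq <| by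
    filter_upwards [isOpen_Ioo.mem_nhds hθ] with t ht using res_apply hf ht

/-- Multiplication by a function that is smooth on `(0, π)`. -/
def mulOp (h : ℝ → ℝ) (hh : ContDiffOn ℝ ∞ h (Ioo 0 π)) : Module.End ℝ smoothFun where
  toFun f := ⟨fun θ => h θ * f.1 θ, hh.mul f.2.1, fun θ hθ => by simp [f.2.2 θ hθ]⟩
  map_add' f g := by ext θ; simp [mul_add]
  map_smul' c f := by ext θ; simp; ring

/-- The derivative with respect to `θ`. -/
def derivOp : Module.End ℝ smoothFun where
  toFun f := res (deriv f.1) (f.2.1.deriv_of_isOpen isOpen_Ioo (by simp))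
  map_add' f g := smoothFun_ext fun θ hθ => by
    simp only [res_apply _ hθ, Submodule.coe_add, Pi.add_apply]
    exact deriv_add (smoothFun_differentiableAt f hθ) (smoothFun_differentiableAt g hθ)
  map_smul' c f := smoothFun_ext fun θ hθ => by
    simp only [res_apply _ hθ, Submodule.coe_smul, Pi.smul_apply, RingHom.id_apply]
    exact deriv_const_smul c (smoothFun_differentiableAt f hθ)

theorem derivOp_apply (f : smoothFun) {θ : ℝ} (hθ : θ ∈ Ioo 0 π) :
    (derivOp f).1 θ = deriv f.1 θ :=
  res_apply (f.2.1.deriv_of_isOpen isOpen_Ioo (by simp)) hθ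

theorem sin_ne_zero_of_mem {θ : ℝ} (hθ : θ ∈ Ioo 0 π) : sin θ ≠ 0 :=
  (sin_pos_of_mem_Ioo hθ).ne'

/-- Multiplication by `sin θ`. -/
def sinOp : Module.End ℝ smoothFun := mulOp sin contDiff_sin.contDiffOn

/-- Multiplication by `cos θ`. -/
def cosOp : Module.End ℝ smoothFun := mulOp cos contDiff_cos.contDiffOn

/-- Division by `sin θ`. -/
def sinInvOp : Module.End ℝ smoothFun :=
  mulOp (fun θ => (sin θ)⁻¹) (contDiff_sin.contDiffOn.inv fun _ hθ => sin_ne_zero_of_mem hθ)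

/-- The derivative with respect to `cos θ`. -/
def dcosOp : Module.End ℝ smoothFun := -(sinInvOp * derivOp)

theorem sinOp_apply (f : smoothFun) (θ : ℝ) : (sinOp f).1 θ = sin θ * f.1 θ := rfl

theorem sinInvOp_apply (f : smoothFun) (θ : ℝ) : (sinInvOp f).1 θ = (sin θ)⁻¹ * f.1 θ := rfl

theorem dcosOp_apply (f : smoothFun) {θ : ℝ} (hθ : θ ∈ Ioo 0 π) :
    (dcosOp f).1 θ = -((sin θ)⁻¹ * deriv f.1 θ) := by
  rw [← derivOp_apply f hθ]; rfl

theorem sinOp_mul_sinInvOp : sinOp * sinInvOp = 1 := by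
  ext1 f
  refine smoothFun_ext fun θ hθ => ?_
  change sin θ * ((sin θ)⁻¹ * f.1 θ) = f.1 θ
  have := sin_ne_zero_of_mem hθ
  field_simp

theorem sinInvOp_mul_sinOp : sinInvOp * sinOp = 1 := by
  ext1 f
  refine smoothFun_ext fun θ hθ => ?_
  change (sin θ)⁻¹ * (sin θ * f.1 θ) = f.1 θ
  have := sin_ne_zero_of_mem hθ
  field_simp

theorem sinOp_mul_cosOp : sinOp * cosOp = cosOp * sinOp := by
  ext1 f
  refine smoothFun_ext fun θ hθ => ?_
  change sin θ * (cos θ * f.1 θ) = cos θ * (sin θ * f.1 θ)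
  ring

theorem dcosOp_mul_cosOp : dcosOp * cosOp = cosOp * dcosOp + 1 := by
  ext1 f
  refine smoothFun_ext fun θ hθ => ?_
  change (dcosOp (cosOp f)).1 θ = cos θ * (dcosOp f).1 θ + f.1 θ
  rw [dcosOp_apply _ hθ, dcosOp_apply _ hθ]
  have h : deriv (cosOp f).1 θ = -sin θ * f.1 θ + cos θ * deriv f.1 θ :=
    ((hasDerivAt_cos θ).mul (smoothFun_differentiableAt f hθ).hasDerivAt).deriv
  have := sin_ne_zero_of_mem hθ
  rw [h]
  field_simp
  ring

theorem dcosOp_mul_sinOp : dcosOp * sinOp = sinOp * dcosOp - cosOp * sinInvOp := by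
  ext1 f
  refine smoothFun_ext fun θ hθ => ?_
  change (dcosOp (sinOp f)).1 θ = sin θ * (dcosOp f).1 θ - cos θ * ((sin θ)⁻¹ * f.1 θ)
  rw [dcosOp_apply _ hθ, dcosOp_apply _ hθ]
  have h : deriv (sinOp f).1 θ = cos θ * f.1 θ + sin θ * deriv f.1 θ :=
    ((hasDerivAt_sin θ).mul (smoothFun_differentiableAt f hθ).hasDerivAt).deriv
  have := sin_ne_zero_of_mem hθ
  rw [h]
  field_simp
  ring

theorem sinOp_mul_dcosOp : sinOp * dcosOp = -derivOp := by
  have h : sinOp * dcosOp = -(sinOp * sinInvOp * derivOp) := by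
    ext1 f
    exact map_neg sinOp _
  rw [h, sinOp_mul_sinInvOp, one_mul]

theorem dcosOp_mul_sinOp_pow_mul_dcosOp_pow (k : ℕ) :
    dcosOp * sinOp ^ (2 * k + 3) * dcosOp ^ (k + 2) =
      sinOp ^ (2 * k + 1) * dcosOp ^ (k + 1) *
        (derivOp ^ 2 + (((k + 1 : ℕ) : ℝ) ^ 2) • (1 : Module.End ℝ smoothFun)) := by
  have h := ladder_rodrigues (R := Module.End ℝ smoothFun) sinOp_mul_sinInvOp sinInvOp_mul_sinOp sinOp_mul_cosOp
    dcosOp_mul_cosOp dcosOp_mul_sinOp k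
  have h' : (sinOp * dcosOp) ^ 2 = derivOp ^ 2 := by
    rw [sinOp_mul_dcosOp]
    ext1 f
    rw [pow_two, pow_two]
    change -derivOp (-derivOp f) = derivOp (derivOp f)
    rw [map_neg, neg_neg]
  rw [h'] at h
  exact h

/-- `(d/d cos θ)^m sin^(2m+1) (d/d cos θ)^(m+1)`. -/
def rodriguesOp (m : ℕ) : Module.End ℝ smoothFun :=
  dcosOp ^ m * sinOp ^ (2 * m + 1) * dcosOp ^ (m + 1)

theorem rodriguesOp_zero : rodriguesOp 0 = -derivOp := by
  simp [rodriguesOp, sinOp_mul_dcosOp]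

/-- By iteration `rodriguesOp m` is -∂ ∏ (∂² + i²), i from 1 to m, so its action on trigonometric
functions is explicit, while its definition displays exactly 2m + 1 derivatives. -/
theorem rodriguesOp_succ (m : ℕ) : rodriguesOp (m + 1) = rodriguesOp m *
    (derivOp ^ 2 + (((m + 1 : ℕ) : ℝ) ^ 2) • (1 : Module.End ℝ smoothFun)) := by
  have h : rodriguesOp (m + 1) =
      dcosOp ^ m * (dcosOp * sinOp ^ (2 * m + 3) * dcosOp ^ (m + 2)) := by
    rw [rodriguesOp, pow_succ dcosOp m]
    simp only [mul_assoc]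
    rfl
  rw [h, dcosOp_mul_sinOp_pow_mul_dcosOp_pow, rodriguesOp]
  simp only [mul_assoc]

/-! ### Action of the operators on the trigonometric functions -/

/-- `cos (k θ)` on `(0, π)`. -/
def cosFun (k : ℕ) : smoothFun := res (fun θ => cos (k * θ)) (by fun_prop)

/-- `sin (k θ)` on `(0, π)`. -/
def sinFun (k : ℕ) : smoothFun := res (fun θ => sin (k * θ)) (by fun_prop)

/-- `θ sin (k θ)` on `(0, π)`. -/
def thetaSinFun (k : ℕ) : smoothFun := res (fun θ => θ * sin (k * θ)) (by fun_prop)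

theorem derivOp_cosFun (k : ℕ) : derivOp (cosFun k) = -(k : ℝ) • sinFun k := by
  refine smoothFun_ext fun θ hθ => ?_
  rw [derivOp_apply _ hθ, cosFun, deriv_res _ hθ]
  change _ = -(k : ℝ) * (sinFun k).1 θ
  rw [sinFun, res_apply _ hθ]
  have h := ((hasDerivAt_id θ).const_mul (k : ℝ)).cos
  simp only [id] at h
  rw [h.deriv]
  simp only [mul_one]
  ring

theorem derivOp_sinFun (k : ℕ) : derivOp (sinFun k) = (k : ℝ) • cosFun k := by
  refine smoothFun_ext fun θ hθ => ?_
  rw [derivOp_apply _ hθ, sinFun, deriv_res _ hθ]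
  change _ = (k : ℝ) * (cosFun k).1 θ
  rw [cosFun, res_apply _ hθ]
  have h := ((hasDerivAt_id θ).const_mul (k : ℝ)).sin
  simp only [id] at h
  rw [h.deriv]
  simp only [mul_one]
  ring

theorem derivOp_sq_thetaSinFun (k : ℕ) :
    (derivOp ^ 2) (thetaSinFun k) = (2 * k : ℝ) • cosFun k - ((k : ℝ) ^ 2) • thetaSinFun k := by
  have hd : ∀ θ, HasDerivAt (fun θ => θ * sin (k * θ)) (sin (k * θ) + θ * (k * cos (k * θ))) θ := by
    intro θ
    have h := (hasDerivAt_id θ).mul ((hasDerivAt_id θ).const_mul (k : ℝ)).sin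
    simp only [id] at h
    exact h.congr_deriv (by ring)
  have hd' : ∀ θ, HasDerivAt (fun θ => sin (k * θ) + θ * (k * cos (k * θ)))
      (2 * k * cos (k * θ) - k ^ 2 * (θ * sin (k * θ))) θ := by
    intro θ
    have h := ((hasDerivAt_id θ).const_mul (k : ℝ)).sin.add
      ((hasDerivAt_id θ).mul (((hasDerivAt_id θ).const_mul (k : ℝ)).cos.const_mul (k : ℝ)))
    simp only [id] at h
    exact h.congr_deriv (by ring)
  have h1 : derivOp (thetaSinFun k) =
      res (fun θ => sin (k * θ) + θ * (k * cos (k * θ))) (by fun_prop) := by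
    refine smoothFun_ext fun θ hθ => ?_
    rw [derivOp_apply _ hθ, thetaSinFun, deriv_res _ hθ, res_apply _ hθ, (hd θ).deriv]
  rw [pow_two]
  change derivOp (derivOp (thetaSinFun k)) = _
  rw [h1]
  refine smoothFun_ext fun θ hθ => ?_
  rw [derivOp_apply _ hθ, deriv_res _ hθ, (hd' θ).deriv]
  change _ = 2 * (k : ℝ) * (cosFun k).1 θ - (k : ℝ) ^ 2 * (thetaSinFun k).1 θ
  rw [cosFun, thetaSinFun, res_apply _ hθ, res_apply _ hθ]

theorem derivOp_sq_cosFun (k : ℕ) : (derivOp ^ 2) (cosFun k) = -((k : ℝ) ^ 2) • cosFun k := by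
  rw [pow_two]
  change derivOp (derivOp (cosFun k)) = _
  rw [derivOp_cosFun, map_smul, derivOp_sinFun]
  module

theorem derivOp_sq_sinFun (k : ℕ) : (derivOp ^ 2) (sinFun k) = -((k : ℝ) ^ 2) • sinFun k := by
  rw [pow_two]
  change derivOp (derivOp (sinFun k)) = _
  rw [derivOp_sinFun, map_smul, derivOp_cosFun]
  module

/-- Polynomials in `cos θ`. -/
def polyFun (p : Polynomial ℝ) : smoothFun :=
  res (fun θ => p.eval (cos θ)) <| by
    have h : ContDiff ℝ ∞ (fun x => p.eval x) := by
      simpa [Polynomial.aeval_def, Polynomial.eval₂_eq_eval_map] using p.contDiff_aeval (𝕜 := ℝ) ∞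
    exact (h.comp contDiff_cos).contDiffOn

theorem dcosOp_polyFun (p : Polynomial ℝ) : dcosOp (polyFun p) = polyFun p.derivative := by
  refine smoothFun_ext fun θ hθ => ?_
  rw [dcosOp_apply _ hθ, polyFun, polyFun, deriv_res _ hθ, res_apply _ hθ]
  have h := (p.hasDerivAt (cos θ)).comp θ (hasDerivAt_cos θ)
  have h' : deriv (fun θ => p.eval (cos θ)) θ = _ := h.deriv
  have := sin_ne_zero_of_mem hθ
  rw [h']
  field_simp

theorem dcosOp_pow_polyFun (j : ℕ) (p : Polynomial ℝ) :
    (dcosOp ^ j) (polyFun p) = polyFun (Polynomial.derivative^[j] p) := by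
  induction j with
  | zero => simp
  | succ j ih =>
    rw [pow_succ', Function.iterate_succ_apply']
    change dcosOp ((dcosOp ^ j) _) = _
    rw [ih, dcosOp_polyFun]

/-- cos (k θ) is the Chebyshev polynomial T_k in cos θ, of degree k. -/
theorem dcosOp_pow_cosFun {j k : ℕ} (h : k < j) : (dcosOp ^ j) (cosFun k) = 0 := by
  have h1 : cosFun k = polyFun (Polynomial.Chebyshev.T ℝ k) := by
    refine smoothFun_ext fun θ hθ => ?_
    rw [cosFun, polyFun, res_apply _ hθ, res_apply _ hθ, Polynomial.Chebyshev.T_real_cos]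
    simp
  rw [h1, dcosOp_pow_polyFun, Polynomial.iterate_derivative_eq_zero]
  · refine smoothFun_ext fun θ hθ => ?_
    rw [polyFun, res_apply _ hθ]; simp
  · rw [Polynomial.Chebyshev.natDegree_T]; simpa using h

theorem sinFun_zero : sinFun 0 = 0 :=
  smoothFun_ext fun θ hθ => by rw [sinFun, res_apply _ hθ]; simp

theorem thetaSinFun_zero : thetaSinFun 0 = 0 :=
  smoothFun_ext fun θ hθ => by rw [thetaSinFun, res_apply _ hθ]; simp

theorem rodriguesOp_succ_apply (r : ℕ) (f : smoothFun) : rodriguesOp (r + 1) f =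
    rodriguesOp r ((derivOp ^ 2) f) + (((r + 1 : ℕ) : ℝ) ^ 2) • rodriguesOp r f := by
  rw [rodriguesOp_succ, ← map_smul, ← map_add]
  rfl

theorem rodriguesOp_succ_cosFun (r k : ℕ) : rodriguesOp (r + 1) (cosFun k) =
    (((r + 1 : ℕ) : ℝ) ^ 2 - (k : ℝ) ^ 2) • rodriguesOp r (cosFun k) := by
  rw [rodriguesOp_succ_apply, derivOp_sq_cosFun, map_smul]
  module

theorem rodriguesOp_succ_sinFun (r k : ℕ) : rodriguesOp (r + 1) (sinFun k) =
    (((r + 1 : ℕ) : ℝ) ^ 2 - (k : ℝ) ^ 2) • rodriguesOp r (sinFun k) := by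
  rw [rodriguesOp_succ_apply, derivOp_sq_sinFun, map_smul]
  module

theorem rodriguesOp_cosFun (r k : ℕ) : ∃ c : ℝ, rodriguesOp r (cosFun k) = c • sinFun k := by
  induction r with
  | zero =>
    refine ⟨k, ?_⟩
    rw [rodriguesOp_zero]
    change -derivOp (cosFun k) = _
    rw [derivOp_cosFun]
    module
  | succ r ih =>
    obtain ⟨c, hc⟩ := ih
    exact ⟨_, by rw [rodriguesOp_succ_cosFun, hc, smul_smul]⟩

theorem rodriguesOp_sinFun (r k : ℕ) : ∃ c : ℝ, rodriguesOp r (sinFun k) = c • cosFun k := by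
  induction r with
  | zero =>
    refine ⟨-k, ?_⟩
    rw [rodriguesOp_zero]
    change -derivOp (sinFun k) = _
    rw [derivOp_sinFun]
    module
  | succ r ih =>
    obtain ⟨c, hc⟩ := ih
    exact ⟨_, by rw [rodriguesOp_succ_sinFun, hc, smul_smul]⟩

theorem rodriguesOp_sinFun_eq_zero {r k : ℕ} (h : k ≤ r) : rodriguesOp r (sinFun k) = 0 := by
  rcases Nat.eq_zero_or_pos k with rfl | hk
  · rw [sinFun_zero, map_zero]
  induction r with
  | zero => omega
  | succ r ih =>
    rw [rodriguesOp_succ_sinFun]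
    rcases Nat.lt_or_ge r k with h' | h'
    · rw [show k = r + 1 by omega, sub_self, zero_smul]
    · rw [ih h', smul_zero]

/-- The factor ∂² + k², present because k ≤ r, sends θ sin (k θ) to 2k cos (k θ); the remaining odd
operator turns the cosine into a multiple of sin (k θ). -/
theorem rodriguesOp_thetaSinFun {r k : ℕ} (h : k ≤ r) :
    ∃ c : ℝ, rodriguesOp r (thetaSinFun k) = c • sinFun k := by
  rcases Nat.eq_zero_or_pos k with rfl | hk
  · exact ⟨0, by rw [thetaSinFun_zero, map_zero, zero_smul]⟩
  induction r with
  | zero => omega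
  | succ r ih =>
    obtain ⟨c, hc⟩ := rodriguesOp_cosFun r k
    have key : rodriguesOp (r + 1) (thetaSinFun k) = (2 * k * c : ℝ) • sinFun k +
        (((r + 1 : ℕ) : ℝ) ^ 2 - (k : ℝ) ^ 2) • rodriguesOp r (thetaSinFun k) := by
      rw [rodriguesOp_succ_apply, derivOp_sq_thetaSinFun, map_sub, map_smul, map_smul, hc]
      module
    rcases Nat.lt_or_ge r k with h' | h'
    · exact ⟨_, by rw [key, show k = r + 1 by omega, sub_self, zero_smul, add_zero]⟩
    · obtain ⟨d, hd⟩ := ih h'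
      exact ⟨2 * k * c + (((r + 1 : ℕ) : ℝ) ^ 2 - (k : ℝ) ^ 2) * d, by rw [key, hd]; module⟩

theorem dcosOp_cosFun (k : ℕ) : dcosOp (cosFun k) = (k : ℝ) • sinInvOp (sinFun k) := by
  change -(sinInvOp (derivOp (cosFun k))) = _
  rw [derivOp_cosFun, map_smul]
  module

theorem dcosOp_sinFun (k : ℕ) : dcosOp (sinFun k) = (-k : ℝ) • sinInvOp (cosFun k) := by
  change -(sinInvOp (derivOp (sinFun k))) = _
  rw [derivOp_sinFun, map_smul]
  module

/-- For k > 0, sin (k θ)/sin θ is D(cos (k θ))/k, a polynomial of degree k - 1 in cos θ. -/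
theorem dcosOp_pow_sinInvOp_sinFun {j k : ℕ} (h : k ≤ j) :
    (dcosOp ^ j) (sinInvOp (sinFun k)) = 0 := by
  rcases Nat.eq_zero_or_pos k with rfl | hk
  · rw [sinFun_zero, map_zero, map_zero]
  have h1 : (dcosOp ^ (j + 1)) (cosFun k) = 0 := dcosOp_pow_cosFun (by omega)
  rw [pow_succ] at h1
  change (dcosOp ^ j) (dcosOp (cosFun k)) = 0 at h1
  rw [dcosOp_cosFun, map_smul] at h1
  exact (smul_eq_zero.1 h1).resolve_left (by positivity)

theorem dcosOp_sinOp_pow_dcosOp_pow_sinFun (k i : ℕ) :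
    dcosOp ((sinOp ^ (2 * (k + 1) + 1)) ((dcosOp ^ (k + 2)) (sinFun i))) =
      (((k + 1 : ℕ) : ℝ) ^ 2 - (i : ℝ) ^ 2) •
        (sinOp ^ (2 * k + 1)) ((dcosOp ^ (k + 1)) (sinFun i)) := by
  have h := congrArg (fun T : Module.End ℝ smoothFun => T (sinFun i))
    (dcosOp_mul_sinOp_pow_mul_dcosOp_pow k)
  change dcosOp ((sinOp ^ (2 * k + 3)) ((dcosOp ^ (k + 2)) (sinFun i))) =
    (sinOp ^ (2 * k + 1)) ((dcosOp ^ (k + 1)) ((derivOp ^ 2) (sinFun i) +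
      (((k + 1 : ℕ) : ℝ) ^ 2) • sinFun i)) at h
  rw [show 2 * (k + 1) + 1 = 2 * k + 3 by ring, h, derivOp_sq_sinFun, ← map_smul, ← map_smul]
  congr 2
  module

/-- Each outer D lowers n by one and brings out the factor n² - i². This factor vanishes once n has
come down to i, that is, at the (n - i + 1)-th D, and j ≤ i leaves enough of them. -/
theorem dcosOp_pow_sinOp_pow_dcosOp_pow_sinFun {i j n : ℕ} (hj : 1 ≤ j) (hji : j ≤ i)
    (hin : i ≤ n) :
    (dcosOp ^ (n - j + 1)) ((sinOp ^ (2 * n + 1)) ((dcosOp ^ (n + 1)) (sinFun i))) = 0 := by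
  induction n, hin using Nat.le_induction with
  | base =>
    obtain ⟨k, rfl⟩ : ∃ k, i = k + 1 := ⟨i - 1, by omega⟩
    rw [pow_succ]
    change (dcosOp ^ (k + 1 - j)) (dcosOp _) = 0
    rw [dcosOp_sinOp_pow_dcosOp_pow_sinFun, sub_self, zero_smul, map_zero]
  | succ n hn ih =>
    obtain ⟨k, rfl⟩ : ∃ k, n = k + 1 := ⟨n - 1, by omega⟩
    rw [pow_succ]
    change (dcosOp ^ (k + 1 + 1 - j)) (dcosOp _) = 0
    rw [dcosOp_sinOp_pow_dcosOp_pow_sinFun, map_smul,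
      show k + 1 + 1 - j = k + 1 - j + 1 by omega, ih, smul_zero]

/-- cos (i θ)/sin θ is a nonzero multiple of D(sin (i θ)), which reduces this to the previous lemma.
-/
theorem dcosOp_pow_sinOp_pow_dcosOp_pow_sinInvOp_cosFun {i j n : ℕ} (hj : 1 ≤ j) (hji : j ≤ i)
    (hin : i ≤ n) :
    (dcosOp ^ (n - j + 1)) ((sinOp ^ (2 * n + 1)) ((dcosOp ^ n) (sinInvOp (cosFun i)))) = 0 := by
  have h := dcosOp_pow_sinOp_pow_dcosOp_pow_sinFun hj hji hin
  have h' : (dcosOp ^ (n + 1)) (sinFun i) = (dcosOp ^ n) (dcosOp (sinFun i)) := by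
    rw [pow_succ]; rfl
  rw [h', dcosOp_sinFun, map_smul, map_smul, map_smul] at h
  have hi : (-i : ℝ) ≠ 0 := by
    have : (i : ℝ) ≠ 0 := by exact_mod_cast (by omega : i ≠ 0)
    simpa using this
  exact (smul_eq_zero.1 h).resolve_left hi

/-- The operator that annihilates the cosines up to `k` and, for `i ≤ r`, the functions
`sin (i θ)` and `θ sin (i θ)`. -/
def cosKiller (r k : ℕ) : Module.End ℝ smoothFun := dcosOp ^ k * sinInvOp * rodriguesOp r

/-- The operator that annihilates, in addition, `sin (i θ)` for `j ≤ i ≤ n`. -/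
def sinKiller (r n j : ℕ) : Module.End ℝ smoothFun :=
  dcosOp ^ (n - j + 1) * sinOp ^ (2 * n + 1) * cosKiller r n

theorem cosKiller_cosFun {r k i : ℕ} (h : i ≤ k) : cosKiller r k (cosFun i) = 0 := by
  obtain ⟨c, hc⟩ := rodriguesOp_cosFun r i
  change (dcosOp ^ k) (sinInvOp (rodriguesOp r (cosFun i))) = 0
  rw [hc, map_smul, map_smul, dcosOp_pow_sinInvOp_sinFun h, smul_zero]

theorem cosKiller_sinFun {r k i : ℕ} (h : i ≤ r) : cosKiller r k (sinFun i) = 0 := by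
  change (dcosOp ^ k) (sinInvOp (rodriguesOp r (sinFun i))) = 0
  rw [rodriguesOp_sinFun_eq_zero h, map_zero, map_zero]

theorem cosKiller_thetaSinFun {r k i : ℕ} (h : i ≤ r) (hr : r ≤ k) :
    cosKiller r k (thetaSinFun i) = 0 := by
  obtain ⟨c, hc⟩ := rodriguesOp_thetaSinFun h
  change (dcosOp ^ k) (sinInvOp (rodriguesOp r (thetaSinFun i))) = 0
  rw [hc, map_smul, map_smul, dcosOp_pow_sinInvOp_sinFun (h.trans hr), smul_zero]

theorem sinKiller_of_cosKiller {r n j : ℕ} {f : smoothFun} (h : cosKiller r n f = 0) :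
    sinKiller r n j f = 0 := by
  change (dcosOp ^ (n - j + 1) * sinOp ^ (2 * n + 1)) (cosKiller r n f) = 0
  rw [h, map_zero]

theorem sinKiller_sinFun {r n j i : ℕ} (hj : 1 ≤ j) (hji : j ≤ i) (hin : i ≤ n) :
    sinKiller r n j (sinFun i) = 0 := by
  obtain ⟨c, hc⟩ := rodriguesOp_sinFun r i
  change (dcosOp ^ (n - j + 1)) ((sinOp ^ (2 * n + 1))
    ((dcosOp ^ n) (sinInvOp (rodriguesOp r (sinFun i))))) = 0
  rw [hc, map_smul, map_smul, map_smul, map_smul,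
    dcosOp_pow_sinOp_pow_dcosOp_pow_sinInvOp_cosFun hj hji hin, smul_zero]

/-! ### Rolle's theorem and the loss of zeros -/

/-- `f` vanishes identically or has fewer than `r` zeros on `(0, π)`. -/
def FewZeros (r : ℕ) (f : smoothFun) : Prop :=
  f = 0 ∨ {θ ∈ Ioo 0 π | f.1 θ = 0}.encard < r

theorem FewZeros.of_dcosOp {r : ℕ} {f : smoothFun} (h : FewZeros r (dcosOp f)) :
    FewZeros (r + 1) f := by
  have hd : ∀ θ ∈ Ioo 0 π, (dcosOp f).1 θ = 0 ↔ deriv f.1 θ = 0 := fun θ hθ => by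
    rw [dcosOp_apply f hθ, neg_eq_zero, mul_eq_zero, inv_eq_zero]
    simp [sin_ne_zero_of_mem hθ]
  rcases h with h | h
  · by_cases hz : ∃ θ₀ ∈ Ioo 0 π, f.1 θ₀ = 0
    · obtain ⟨θ₀, hθ₀, hf⟩ := hz
      refine Or.inl (smoothFun_ext fun θ hθ => ?_)
      have := isOpen_Ioo.is_const_of_deriv_eq_zero isPreconnected_Ioo
        (f.2.1.differentiableOn (by simp))
        (fun t ht => (hd t ht).1 (by rw [h]; rfl)) hθ hθ₀
      rw [this, hf]; rfl
    · push Not at hz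
      right
      have : {θ ∈ Ioo 0 π | f.1 θ = 0} = ∅ := by
        ext θ; simpa using fun h1 h2 => hz θ ⟨h1, h2⟩
      rw [this, encard_empty]
      exact_mod_cast Nat.succ_pos r
  · right
    by_contra! hcon
    have hfin : {θ ∈ Ioo 0 π | (dcosOp f).1 θ = 0}.Finite := finite_of_encard_le_coe h.le
    obtain ⟨s, hs, hcard⟩ := exists_subset_encard_eq hcon
    have hsfin : s.Finite := finite_of_encard_eq_coe hcard
    -- Only finitely many chosen zeros of f are used: between two neighbours Rolle gives a zero of
    -- the derivative, so the two finite sets interleave.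
    have key : hsfin.toFinset.card ≤ hfin.toFinset.card + 1 := by
      refine Finset.card_le_of_interleaved fun x hx y hy hxy _ => ?_
      obtain ⟨hx0, hxz⟩ := hs (hsfin.mem_toFinset.1 hx)
      obtain ⟨hy0, hyz⟩ := hs (hsfin.mem_toFinset.1 hy)
      have hsub : Icc x y ⊆ Ioo 0 π := fun t ht => ⟨hx0.1.trans_le ht.1, ht.2.trans_lt hy0.2⟩
      obtain ⟨c, hc, hc'⟩ := exists_deriv_eq_zero hxy (f.2.1.continuousOn.mono hsub)
        (by rw [hxz, hyz])
      have hc0 := hsub (Ioo_subset_Icc_self hc)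
      exact ⟨c, by simpa using ⟨hc0, (hd c hc0).2 hc'⟩, hc⟩
    rw [hfin.encard_eq_coe_toFinset_card] at h
    rw [hsfin.encard_eq_coe_toFinset_card] at hcard
    norm_cast at h hcard
    omega

theorem FewZeros.of_zeros_iff {r : ℕ} {f g : smoothFun}
    (hfg : ∀ θ ∈ Ioo 0 π, g.1 θ = 0 ↔ f.1 θ = 0) (h : FewZeros r g) : FewZeros r f := by
  rcases h with h | h
  · exact Or.inl (smoothFun_ext fun θ hθ => (hfg θ hθ).1 (by rw [h]; rfl))
  · right
    convert h using 3
    ext θ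
    exact ⟨fun ⟨h1, h2⟩ => ⟨h1, (hfg θ h1).2 h2⟩, fun ⟨h1, h2⟩ => ⟨h1, (hfg θ h1).1 h2⟩⟩

/-- The number of zeros of `f` exceeds that of `T f` by at most `r`. -/
def ZeroLoss (r : ℕ) (T : Module.End ℝ smoothFun) : Prop :=
  ∀ f j, FewZeros j (T f) → FewZeros (j + r) f

theorem ZeroLoss.one : ZeroLoss 0 1 := fun _ _ h => h

theorem ZeroLoss.mul {r s : ℕ} {T U : Module.End ℝ smoothFun} (hT : ZeroLoss r T)
    (hU : ZeroLoss s U) : ZeroLoss (r + s) (T * U) := fun f j h => by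
  rw [← add_assoc]
  exact hU f _ (hT (U f) j h)

theorem ZeroLoss.pow {r : ℕ} {T : Module.End ℝ smoothFun} (hT : ZeroLoss r T) (k : ℕ) :
    ZeroLoss (k * r) (T ^ k) := by
  induction k with
  | zero => simpa using ZeroLoss.one
  | succ k ih => rw [pow_succ, Nat.succ_mul]; exact ih.mul hT

theorem zeroLoss_dcosOp_pow (k : ℕ) : ZeroLoss k (dcosOp ^ k) := by
  simpa using ZeroLoss.pow (r := 1) (fun _ _ h => h.of_dcosOp) k

theorem zeroLoss_sinOp_pow (k : ℕ) : ZeroLoss 0 (sinOp ^ k) := by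
  have : ZeroLoss 0 sinOp := fun f j h => h.of_zeros_iff fun θ hθ => by
    rw [sinOp_apply, mul_eq_zero]; simp [sin_ne_zero_of_mem hθ]
  simpa using this.pow k

theorem zeroLoss_sinInvOp : ZeroLoss 0 sinInvOp := fun f j h => h.of_zeros_iff fun θ hθ => by
  rw [sinInvOp_apply, mul_eq_zero, inv_eq_zero]; simp [sin_ne_zero_of_mem hθ]

/-- Only the k + r + (r + 1) factors D cost zeros. This number is the length of the annihilated
block (`length_cosBlock`), which makes the final bound sharp enough. -/
theorem zeroLoss_cosKiller (r k : ℕ) : ZeroLoss (2 * r + k + 1) (cosKiller r k) := by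
  have h := ((zeroLoss_dcosOp_pow k).mul zeroLoss_sinInvOp).mul
    (((zeroLoss_dcosOp_pow r).mul (zeroLoss_sinOp_pow (2 * r + 1))).mul
      (zeroLoss_dcosOp_pow (r + 1)))
  rwa [show k + 0 + (r + 0 + (r + 1)) = 2 * r + k + 1 by ring] at h

theorem zeroLoss_sinKiller (r : ℕ) {n j : ℕ} (hj : j ≤ n) :
    ZeroLoss (2 * r + 2 * n + 2 - j) (sinKiller r n j) := by
  have h := ((zeroLoss_dcosOp_pow (n - j + 1)).mul (zeroLoss_sinOp_pow (2 * n + 1))).mul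
    (zeroLoss_cosKiller r n)
  rwa [show n - j + 1 + 0 + (2 * r + n + 1) = 2 * r + 2 * n + 2 - j by omega] at h

/-! ### Combinatorics of the ordered lists -/

/-- The list `c₀, c₁, s₁, d₁, …, c_r, s_r, d_r`. -/
def tripleBlock {α : Type*} (c s d : ℕ → α) (r : ℕ) : List α :=
  c 0 :: (List.Ico 1 (r + 1)).flatMap fun k => [c k, s k, d k]

/-- The list `c₀, c₁, s₁, d₁, …, c_r, s_r, d_r, c_{r+1}, …, c_n`. -/
def cosBlock {α : Type*} (c s d : ℕ → α) (r n : ℕ) : List α :=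
  tripleBlock c s d r ++ (List.Ico (r + 1) (n + 1)).map c

/-- The list `c₀, c₁, s₁, d₁, …, c_r, s_r, d_r, c_{r+1}, …, c_n, s_n, …, s_j`. -/
def fullBlock {α : Type*} (c s d : ℕ → α) (r n j : ℕ) : List α :=
  cosBlock c s d r n ++ ((List.Ico j (n + 1)).map s).reverse

section Blocks

variable {α : Type*} (c s d : ℕ → α)

theorem tripleBlock_succ (r : ℕ) : tripleBlock c s d (r + 1) =
    tripleBlock c s d r ++ [c (r + 1)] ++ [s (r + 1)] ++ [d (r + 1)] := by
  simp [tripleBlock, List.Ico.succ_top (show 1 ≤ r + 1 by omega)]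

theorem cosBlock_self (r : ℕ) : cosBlock c s d r r = tripleBlock c s d r := by
  simp [cosBlock]

theorem cosBlock_succ {r n : ℕ} (h : r ≤ n) :
    cosBlock c s d r (n + 1) = cosBlock c s d r n ++ [c (n + 1)] := by
  simp [cosBlock, List.Ico.succ_top (show r + 1 ≤ n + 1 by omega)]

theorem fullBlock_succ (r n : ℕ) : fullBlock c s d r n (n + 1) = cosBlock c s d r n := by
  simp [fullBlock]

theorem fullBlock_eq_concat {r n j : ℕ} (h : j ≤ n) :
    fullBlock c s d r n j = fullBlock c s d r n (j + 1) ++ [s j] := by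
  simp [fullBlock, List.Ico.eq_cons (show j < n + 1 by omega)]

theorem length_tripleBlock (r : ℕ) : (tripleBlock c s d r).length = 3 * r + 1 := by
  induction r with
  | zero => simp [tripleBlock]
  | succ r ih => rw [tripleBlock_succ]; simp [ih]; ring

theorem length_cosBlock {r n : ℕ} (h : r ≤ n) : (cosBlock c s d r n).length = 2 * r + n + 1 := by
  simp [cosBlock, length_tripleBlock]; omega

theorem length_fullBlock {r n j : ℕ} (h : r ≤ n) (hj : j ≤ n) :
    (fullBlock c s d r n j).length = 2 * r + 2 * n + 2 - j := by
  simp [fullBlock, length_cosBlock c s d h]; omega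

theorem mem_tripleBlock {r : ℕ} {x : α} (h : x ∈ tripleBlock c s d r) :
    x = c 0 ∨ ∃ k, 1 ≤ k ∧ k ≤ r ∧ (x = c k ∨ x = s k ∨ x = d k) := by
  simp only [tripleBlock, List.mem_cons, List.mem_flatMap, List.Ico.mem, List.not_mem_nil,
    or_false] at h
  rcases h with rfl | ⟨k, hk, h⟩
  · exact Or.inl rfl
  · exact Or.inr ⟨k, by omega, by omega, h⟩

theorem mem_cosBlock {r n : ℕ} (hrn : r ≤ n) {x : α} (h : x ∈ cosBlock c s d r n) :
    (∃ k ≤ n, x = c k) ∨ ∃ k, 1 ≤ k ∧ k ≤ r ∧ (x = s k ∨ x = d k) := by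
  rcases List.mem_append.1 h with h | h
  · obtain h | ⟨k, hk, hkr, h | h⟩ := mem_tripleBlock c s d h
    · exact Or.inl ⟨0, by omega, h⟩
    · exact Or.inl ⟨k, by omega, h⟩
    · exact Or.inr ⟨k, hk, hkr, h⟩
  · simp only [List.mem_map, List.Ico.mem] at h
    obtain ⟨k, hk, rfl⟩ := h
    exact Or.inl ⟨k, by omega, rfl⟩

theorem mem_fullBlock {r n j : ℕ} {x : α} (h : x ∈ fullBlock c s d r n j) :
    x ∈ cosBlock c s d r n ∨ ∃ k, j ≤ k ∧ k ≤ n ∧ x = s k := by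
  rcases List.mem_append.1 h with h | h
  · exact Or.inl h
  · simp only [List.mem_reverse, List.mem_map, List.Ico.mem] at h
    obtain ⟨k, hk, rfl⟩ := h
    exact Or.inr ⟨k, by omega, by omega, rfl⟩

end Blocks

/-! ### Annihilation of every prefix -/

/-- Some operator of zero loss at most the length of `L` annihilates the members of `L`. -/
def Annihilated (L : List smoothFun) : Prop :=
  ∃ T, ZeroLoss L.length T ∧ ∀ g ∈ L, T g = 0

theorem annihilated_cosBlock {r n : ℕ} (h : r ≤ n) :
    Annihilated (cosBlock cosFun sinFun thetaSinFun r n) := by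
  refine ⟨cosKiller r n, ?_, fun g hg => ?_⟩
  · rw [length_cosBlock _ _ _ h]; exact zeroLoss_cosKiller r n
  · rcases mem_cosBlock _ _ _ h hg with ⟨k, hk, rfl⟩ | ⟨k, -, hk, rfl | rfl⟩
    exacts [cosKiller_cosFun hk, cosKiller_sinFun hk, cosKiller_thetaSinFun hk h]

theorem annihilated_fullBlock {r n j : ℕ} (h : r ≤ n) (h1 : 1 ≤ j) (hj : j ≤ n) :
    Annihilated (fullBlock cosFun sinFun thetaSinFun r n j) := by
  refine ⟨sinKiller r n j, ?_, fun g hg => ?_⟩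
  · rw [length_fullBlock _ _ _ h hj]; exact zeroLoss_sinKiller r hj
  · rcases mem_fullBlock _ _ _ hg with hg | ⟨k, hjk, hkn, rfl⟩
    · refine sinKiller_of_cosKiller ?_
      rcases mem_cosBlock _ _ _ h hg with ⟨k, hk, rfl⟩ | ⟨k, -, hk, rfl | rfl⟩
      exacts [cosKiller_cosFun hk, cosKiller_sinFun hk, cosKiller_thetaSinFun hk h]
    · exact sinKiller_sinFun h1 hjk hkn

/-- Every prefix of `L` is annihilated. -/
def PrefixAnnihilated (L : List smoothFun) : Prop := ∀ L', L' <+: L → Annihilated L'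

theorem PrefixAnnihilated.concat {L : List smoothFun} {g : smoothFun} (h : PrefixAnnihilated L)
    (hg : Annihilated (L ++ [g])) : PrefixAnnihilated (L ++ [g]) := fun L' h' => by
  rcases List.prefix_concat_iff.1 h' with rfl | h'
  · exact hg
  · exact h L' h'

/-- Each of the three prefixes that appear when r grows is itself a block: with c added it is
`cosBlock` for (r, r+1), with s as well it is `fullBlock` for (r, r+1, r+1), with d as well it is
`cosBlock` for (r+1, r+1). -/
theorem prefixAnnihilated_tripleBlock (r : ℕ) :
    PrefixAnnihilated (tripleBlock cosFun sinFun thetaSinFun r) := by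
  induction r with
  | zero =>
    have h : PrefixAnnihilated [] := fun L' h' => by
      rw [List.prefix_nil.1 h']
      exact ⟨1, ZeroLoss.one, by simp⟩
    have h0 := annihilated_cosBlock (le_refl 0)
    rw [cosBlock_self] at h0
    exact h.concat h0
  | succ r ih =>
    have h1 := annihilated_cosBlock (Nat.le_succ r)
    rw [Nat.succ_eq_add_one, cosBlock_succ _ _ _ le_rfl, cosBlock_self] at h1
    have h2 := annihilated_fullBlock (Nat.le_succ r) (Nat.succ_pos r) le_rfl
    rw [Nat.succ_eq_add_one, fullBlock_eq_concat _ _ _ le_rfl, fullBlock_succ,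
      cosBlock_succ _ _ _ le_rfl, cosBlock_self] at h2
    have h3 := annihilated_cosBlock (le_refl (r + 1))
    rw [cosBlock_self, tripleBlock_succ] at h3
    rw [tripleBlock_succ]
    exact ((ih.concat h1).concat h2).concat h3

theorem prefixAnnihilated_cosBlock {r n : ℕ} (h : r ≤ n) :
    PrefixAnnihilated (cosBlock cosFun sinFun thetaSinFun r n) := by
  induction n, h using Nat.le_induction with
  | base => rw [cosBlock_self]; exact prefixAnnihilated_tripleBlock r
  | succ n hn ih =>
    have h1 := annihilated_cosBlock (hn.trans (Nat.le_succ n))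
    rw [Nat.succ_eq_add_one, cosBlock_succ _ _ _ hn] at h1
    rw [cosBlock_succ _ _ _ hn]
    exact ih.concat h1

/-- The induction descends in j because the sines enter from s_n downwards; `sinKiller` annihilates
just such upper ranges of sines. -/
theorem prefixAnnihilated_fullBlock {r n j : ℕ} (h : r ≤ n) (h1 : 1 ≤ j) (hj : j ≤ n + 1) :
    PrefixAnnihilated (fullBlock cosFun sinFun thetaSinFun r n j) := by
  induction hj using Nat.decreasingInduction with
  | self => rw [fullBlock_succ]; exact prefixAnnihilated_cosBlock h
  | of_succ j hj ih =>
    have h2 := annihilated_fullBlock h h1 (show j ≤ n by omega)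
    rw [fullBlock_eq_concat _ _ _ (by omega)] at h2 ⊢
    exact (ih (by omega)).concat h2

/-! ### Linear independence of the trigonometric functions -/

theorem eval_cos_injective {p : Polynomial ℝ} (h : ∀ θ : ℝ, p.eval (cos θ) = 0) : p = 0 := by
  refine Polynomial.eq_zero_of_infinite_isRoot p ?_
  refine (Icc_infinite (show (-1 : ℝ) < 1 by norm_num)).mono fun x hx => ?_
  have := h (arccos x)
  rwa [cos_arccos hx.1 hx.2] at this

theorem linearIndependent_cos :
    LinearIndependent ℝ (fun (k : ℕ) (θ : ℝ) => cos (k * θ)) := by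
  let S : Polynomial.Sequence ℝ := ⟨fun k => Polynomial.Chebyshev.T ℝ k, fun k => by
    rw [Polynomial.Chebyshev.degree_T]; simp⟩
  let φ : Polynomial ℝ →ₗ[ℝ] (ℝ → ℝ) :=
    { toFun := fun p θ => p.eval (cos θ)
      map_add' := fun p q => by ext; simp
      map_smul' := fun c p => by ext; simp }
  have hφ : LinearMap.ker φ = ⊥ :=
    LinearMap.ker_eq_bot'.2 fun p hp => eval_cos_injective fun θ => congrFun hp θ
  have h := S.linearIndependent.map' φ hφ
  have he : (φ ∘ S) = fun (k : ℕ) θ => cos (k * θ) := by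
    ext k θ
    change (Polynomial.Chebyshev.T ℝ k).eval (cos θ) = _
    rw [Polynomial.Chebyshev.T_real_cos]
    simp
  exact he ▸ h

theorem linearIndependent_sin :
    LinearIndependent ℝ (fun (k : ℕ) (θ : ℝ) => sin ((k + 1 : ℕ) * θ)) := by
  let S : Polynomial.Sequence ℝ := ⟨fun k => Polynomial.Chebyshev.U ℝ k, fun k => by
    rw [Polynomial.Chebyshev.degree_U_natCast]⟩
  let φ : Polynomial ℝ →ₗ[ℝ] (ℝ → ℝ) :=
    { toFun := fun p θ => p.eval (cos θ) * sin θ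
      map_add' := fun p q => by ext; simp; ring
      map_smul' := fun c p => by ext; simp; ring }
  have hφ : LinearMap.ker φ = ⊥ := by
    refine LinearMap.ker_eq_bot'.2 fun p hp => ?_
    refine Polynomial.eq_zero_of_infinite_isRoot p ?_
    refine (Ioo_infinite (show (-1 : ℝ) < 1 by norm_num)).mono fun x hx => ?_
    have h : p.eval (cos (arccos x)) * sin (arccos x) = 0 := congrFun hp (arccos x)
    rw [cos_arccos hx.1.le hx.2.le, sin_arccos] at h
    refine (mul_eq_zero.1 h).resolve_right (sqrt_ne_zero'.2 ?_)
    nlinarith [hx.1, hx.2]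
  have h := S.linearIndependent.map' φ hφ
  have he : (φ ∘ S) = fun (k : ℕ) θ => sin ((k + 1 : ℕ) * θ) := by
    ext k θ
    change (Polynomial.Chebyshev.U ℝ k).eval (cos θ) * sin θ = _
    rw [Polynomial.Chebyshev.U_real_cos]
    simp
  exact he ▸ h

/-- Multiplication by `θ`. -/
def mulVar : (ℝ → ℝ) →ₗ[ℝ] (ℝ → ℝ) where
  toFun f θ := θ * f θ
  map_add' f g := by ext; simp [mul_add]
  map_smul' c f := by ext; simp; ring

/-- Functions of period `2π`. -/
def periodicFun : Submodule ℝ (ℝ → ℝ) where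
  carrier := {f | Function.Periodic f (2 * π)}
  add_mem' hf hg := hf.add hg
  zero_mem' _ := rfl
  smul_mem' c _ hf := hf.smul c

/-- Functions `f` with `f (-θ) = ε f θ`. -/
def parityFun (ε : ℝ) : Submodule ℝ (ℝ → ℝ) where
  carrier := {f | ∀ θ, f (-θ) = ε * f θ}
  add_mem' hf hg θ := by simp [hf θ, hg θ, mul_add]
  zero_mem' _ := by simp
  smul_mem' c f hf θ := by simp [hf θ]; ring

theorem cos_mem_periodicFun (k : ℕ) : (fun θ : ℝ => cos (k * θ)) ∈ periodicFun := fun θ => by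
  beta_reduce
  rw [mul_add, cos_add_nat_mul_two_pi]

theorem sin_mem_periodicFun (k : ℕ) : (fun θ : ℝ => sin (k * θ)) ∈ periodicFun := fun θ => by
  beta_reduce
  rw [mul_add, sin_add_nat_mul_two_pi]

/-- If θ h(θ) and h are both 2π-periodic, comparison at θ and θ + 2π gives 2π h(θ) = 0. -/
theorem disjoint_periodicFun : Disjoint periodicFun (periodicFun.map mulVar) := by
  rw [Submodule.disjoint_def]
  rintro _ hf ⟨h, hh, rfl⟩
  ext θ
  have h1 : (θ + 2 * π) * h (θ + 2 * π) = θ * h θ := hf θ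
  rw [hh θ] at h1
  have h2 : h θ = 0 := by
    have : 2 * π * h θ = 0 := by linarith
    exact (mul_eq_zero.1 this).resolve_left (by positivity)
  change θ * h θ = 0
  rw [h2, mul_zero]

theorem disjoint_parityFun : Disjoint (parityFun 1) (parityFun (-1)) := by
  rw [Submodule.disjoint_def]
  intro f h1 h2
  ext θ
  have := (h1 θ).symm.trans (h2 θ)
  simp only [Pi.zero_apply]
  linarith

theorem linearIndependent_thetaSin :
    LinearIndependent ℝ (fun (k : ℕ) (θ : ℝ) => θ * sin ((k + 1 : ℕ) * θ)) := by
  refine linearIndependent_sin.map (f := mulVar) ?_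
  rw [Submodule.disjoint_def]
  intro f hf hk
  have hper : f ∈ periodicFun := Submodule.span_le.2
    (range_subset_iff.2 fun k => sin_mem_periodicFun (k + 1)) hf
  ext θ
  have h1 : θ * f θ = 0 := congrFun hk θ
  have h2 : (θ + 2 * π) * f (θ + 2 * π) = 0 := congrFun hk _
  rw [hper θ] at h2
  have : 2 * π * f θ = 0 := by linarith
  exact (mul_eq_zero.1 this).resolve_left (by positivity)

/-- The functions `cos (k θ)`, `sin ((k + 1) θ)` and `θ sin ((k + 1) θ)`. -/
def trigFamily : (ℕ ⊕ ℕ) ⊕ ℕ → ℝ → ℝ :=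
  Sum.elim (Sum.elim (fun k θ => cos (k * θ)) fun k θ => sin ((k + 1 : ℕ) * θ))
    fun k θ => θ * sin ((k + 1 : ℕ) * θ)

/-- Parity separates the cosines from the sines, and periodicity separates both from the
θ-multiples. -/
theorem linearIndependent_trigFamily : LinearIndependent ℝ trigFamily := by
  refine LinearIndependent.sum_type (linearIndependent_cos.sum_type linearIndependent_sin ?_)
    linearIndependent_thetaSin ?_
  · refine disjoint_parityFun.mono (Submodule.span_le.2 (range_subset_iff.2 fun k => ?_))
      (Submodule.span_le.2 (range_subset_iff.2 fun k => ?_))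
    · intro θ; simp
    · intro θ; simp
  · refine disjoint_periodicFun.mono (Submodule.span_le.2 (range_subset_iff.2 ?_))
      (Submodule.span_le.2 (range_subset_iff.2 fun k => ?_))
    · rintro (k | k)
      exacts [cos_mem_periodicFun k, sin_mem_periodicFun (k + 1)]
    · exact ⟨_, sin_mem_periodicFun (k + 1), rfl⟩

theorem analyticOnNhd_trigFamily (i : (ℕ ⊕ ℕ) ⊕ ℕ) : AnalyticOnNhd ℝ (trigFamily i) univ := by
  intro θ _
  rcases i with (k | k) | k
  · exact analyticAt_cos.comp (analyticAt_const.mul analyticAt_id)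
  · exact analyticAt_sin.comp (analyticAt_const.mul analyticAt_id)
  · exact analyticAt_id.mul (analyticAt_sin.comp (analyticAt_const.mul analyticAt_id))

/-- The functions `cos (k θ)`, `sin ((k + 1) θ)` and `θ sin ((k + 1) θ)` on `(0, π)`. -/
def trigFun : (ℕ ⊕ ℕ) ⊕ ℕ → smoothFun :=
  Sum.elim (Sum.elim cosFun fun k => sinFun (k + 1)) fun k => thetaSinFun (k + 1)

theorem trigFun_apply (i : (ℕ ⊕ ℕ) ⊕ ℕ) {θ : ℝ} (hθ : θ ∈ Ioo 0 π) :
    (trigFun i).1 θ = trigFamily i θ := by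
  rcases i with (k | k) | k
  exacts [indicator_of_mem hθ (fun θ => cos (k * θ)),
    indicator_of_mem hθ (fun θ => sin ((k + 1 : ℕ) * θ)),
    indicator_of_mem hθ (fun θ => θ * sin ((k + 1 : ℕ) * θ))]

theorem smoothFun_sum_apply {ι : Type*} (s : Finset ι) (f : ι → smoothFun) (θ : ℝ) :
    (∑ i ∈ s, f i).1 θ = ∑ i ∈ s, (f i).1 θ := by
  rw [Submodule.coe_sum, Finset.sum_apply]

/-- Parity and periodicity need the whole line; a relation valid only on (0, π) extends to it by
analyticity. -/
theorem linearIndependent_trigFun : LinearIndependent ℝ trigFun := by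
  rw [linearIndependent_iff']
  intro s a h
  refine linearIndependent_iff'.1 linearIndependent_trigFamily s a ?_
  have han : AnalyticOnNhd ℝ (∑ i ∈ s, a i • trigFamily i) univ := fun θ _ =>
    Finset.analyticAt_sum s fun i _ =>
      (analyticOnNhd_trigFamily i θ (mem_univ θ)).const_smul
  refine han.eq_of_eventuallyEq (z₀ := π / 2) (fun _ _ => analyticAt_const) ?_
  filter_upwards [isOpen_Ioo.mem_nhds
    (show π / 2 ∈ Ioo 0 π from ⟨by positivity, by linarith [pi_pos]⟩)] with θ hθ
  have h' : (∑ i ∈ s, a i • trigFun i).1 θ = 0 := by rw [h]; rfl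
  rw [smoothFun_sum_apply] at h'
  rw [Finset.sum_apply, Pi.zero_apply, ← h']
  exact Finset.sum_congr rfl fun i _ => by
    change a i * _ = a i * _
    rw [trigFun_apply i hθ]

/-- The indices in `trigFun` of the members of a block. -/
def blockIndex (r n j : ℕ) : List ((ℕ ⊕ ℕ) ⊕ ℕ) :=
  fullBlock (fun k => Sum.inl (Sum.inl k)) (fun k => Sum.inl (Sum.inr (k - 1)))
    (fun k => Sum.inr (k - 1)) r n j

/-- The condition r < j keeps the sines of the triples apart from those of the tail. -/
theorem nodup_blockIndex {r n j : ℕ} (hrn : r ≤ n) (hj : r < j) : (blockIndex r n j).Nodup := by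
  have h3 : ∀ r, (tripleBlock (fun k => (Sum.inl (Sum.inl k) : (ℕ ⊕ ℕ) ⊕ ℕ))
      (fun k => Sum.inl (Sum.inr (k - 1))) (fun k => Sum.inr (k - 1)) r).Nodup := by
    intro r
    induction r with
    | zero => simp [tripleBlock]
    | succ r ih =>
      rw [tripleBlock_succ, List.append_assoc, List.append_assoc]
      refine ih.append (by simp) fun x hx hx' => ?_
      rcases mem_tripleBlock _ _ _ hx with rfl | ⟨k, hk, hkr, rfl | rfl | rfl⟩ <;>
        simp at hx' <;> omega
  refine List.Nodup.append (List.Nodup.append (h3 r) ?_ fun x hx hx' => ?_) ?_ fun x hx hx' => ?_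
  · exact (List.Ico.nodup _ _).map fun a b h => by simpa using h
  · simp only [List.mem_map, List.Ico.mem] at hx'
    obtain ⟨i, hi, rfl⟩ := hx'
    rcases mem_tripleBlock _ _ _ hx with h | ⟨k, hk, hkr, h | h | h⟩ <;> simp at h <;> omega
  · refine List.nodup_reverse.2 (List.Nodup.map_on (fun a ha b hb h => ?_) (List.Ico.nodup _ _))
    rw [List.Ico.mem] at ha hb
    simp at h
    omega
  · simp only [List.mem_reverse, List.mem_map, List.Ico.mem] at hx'
    obtain ⟨i, hi, rfl⟩ := hx'
    rcases mem_cosBlock _ _ _ hrn hx with ⟨k, hk, h⟩ | ⟨k, hk, hkr, h | h⟩ <;> simp at h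
    omega

theorem map_fullBlock {α γ : Type*} (φ : α → γ) (c s d : ℕ → α) (r n j : ℕ) :
    (fullBlock c s d r n j).map φ =
      fullBlock (fun k => φ (c k)) (fun k => φ (s k)) (fun k => φ (d k)) r n j := by
  simp [fullBlock, cosBlock, tripleBlock, List.map_flatMap, Function.comp_def]

theorem fullBlock_congr {α : Type*} {c s d s' d' : ℕ → α} {r n j : ℕ} (hj : 1 ≤ j)
    (hs : ∀ k, 1 ≤ k → s k = s' k) (hd : ∀ k, 1 ≤ k → d k = d' k) :
    fullBlock c s d r n j = fullBlock c s' d' r n j := by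
  have h1 : (List.Ico 1 (r + 1)).flatMap (fun k => [c k, s k, d k]) =
      (List.Ico 1 (r + 1)).flatMap fun k => [c k, s' k, d' k] :=
    List.flatMap_congr fun k hk => by
      rw [hs k (List.Ico.mem.1 hk).1, hd k (List.Ico.mem.1 hk).1]
  have h2 : (List.Ico j (n + 1)).map s = (List.Ico j (n + 1)).map s' :=
    List.map_congr_left fun k hk => hs k (hj.trans (List.Ico.mem.1 hk).1)
  simp only [fullBlock, cosBlock, tripleBlock, h1, h2]

theorem map_trigFun_blockIndex {r n j : ℕ} (hj : 1 ≤ j) :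
    (blockIndex r n j).map trigFun = fullBlock cosFun sinFun thetaSinFun r n j := by
  rw [blockIndex, map_fullBlock]
  refine fullBlock_congr hj (fun k hk => ?_) fun k hk => ?_
  · change sinFun (k - 1 + 1) = _
    rw [Nat.sub_add_cancel hk]
  · change thetaSinFun (k - 1 + 1) = _
    rw [Nat.sub_add_cancel hk]

theorem linearIndependent_fullBlock {r n j : ℕ} (hrn : r ≤ n) (hj : r < j) :
    LinearIndependent ℝ (fullBlock cosFun sinFun thetaSinFun r n j).get := by
  rw [← map_trigFun_blockIndex (by omega : 1 ≤ j)]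
  have h := linearIndependent_trigFun.comp _
    (List.nodup_iff_injective_get.1 (nodup_blockIndex (n := n) hrn hj))
  have h2 := h.comp (Fin.cast (List.length_map (as := blockIndex r n j) trigFun))
    (Fin.cast_injective _)
  convert h2 using 1
  ext i
  simp

/-- Every nontrivial combination of the first `k` members of `L` has fewer than `k` zeros
on `(0, π)`, and does not vanish there identically. -/
def IsCT (L : List smoothFun) : Prop :=
  ∀ (k : ℕ) (hk : k ≤ L.length) (a : Fin k → ℝ), a ≠ 0 →
    {θ ∈ Ioo 0 π | (∑ i : Fin k, a i • L.get (Fin.castLE hk i)).1 θ = 0}.encard < k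

theorem PrefixAnnihilated.isCT {L : List smoothFun} (h : PrefixAnnihilated L)
    (hL : LinearIndependent ℝ L.get) : IsCT L := by
  intro k hk a ha
  obtain ⟨T, hT, hker⟩ := h (L.take k) (List.take_prefix k L)
  rw [List.length_take, min_eq_left hk] at hT
  have h0 : T (∑ i : Fin k, a i • L.get (Fin.castLE hk i)) = 0 := by
    rw [map_sum]
    refine Finset.sum_eq_zero fun i _ => ?_
    rw [map_smul, hker _ ?_, smul_zero]
    rw [List.mem_take_iff_getElem]
    exact ⟨i, by simp; omega, rfl⟩
  -- The image is zero, so it satisfies `FewZeros 0` through its first alternative.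
  have hz := hT _ 0 (Or.inl h0)
  rw [zero_add] at hz
  refine hz.resolve_left fun hsum => ha ?_
  have := Fintype.linearIndependent_iff.1 (hL.comp _ (Fin.castLE_injective hk)) a hsum
  exact funext this

theorem isCT_fullBlock {r n j : ℕ} (hrn : r ≤ n) (hj : r < j) (hjn : j ≤ n + 1) :
    IsCT (fullBlock cosFun sinFun thetaSinFun r n j) :=
  (prefixAnnihilated_fullBlock hrn (by omega) hjn).isCT (linearIndependent_fullBlock hrn hj)

/-! ### Zeros counted with multiplicity -/

/-- The zeros of `f` on `U`, counted with multiplicity, are at most `s`. -/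
def ZerosLE (f : ℝ → ℝ) (U : Set ℝ) (s : ℕ) : Prop :=
  ∀ Z : Finset ℝ, (Z : Set ℝ) ⊆ U → ∑ x ∈ Z, analyticOrderAt f x ≤ (s : ℕ∞)

theorem ZerosLE.congr_order {f g : ℝ → ℝ} {U : Set ℝ} {s : ℕ} (h : ZerosLE g U s)
    (hfg : ∀ x ∈ U, analyticOrderAt f x = analyticOrderAt g x) : ZerosLE f U s := fun Z hZ => by
  rw [Finset.sum_congr rfl fun x hx => hfg x (hZ hx)]
  exact h Z hZ

theorem ZerosLE.encard_le {f : ℝ → ℝ} {U : Set ℝ} {s : ℕ} (h : ZerosLE f U s)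
    (hf : AnalyticOnNhd ℝ f U) : {x ∈ U | f x = 0}.encard ≤ s := by
  by_contra! hcon
  obtain ⟨t, ht, hcard⟩ := exists_subset_encard_eq (Order.add_one_le_of_lt hcon)
  have htfin : t.Finite := finite_of_encard_eq_coe (k := s + 1) (by rw [hcard]; norm_cast)
  have h1 := h htfin.toFinset fun x hx => (ht (htfin.mem_toFinset.1 hx)).1
  have h2 : (htfin.toFinset.card : ℕ∞) ≤ ∑ x ∈ htfin.toFinset, analyticOrderAt f x := by
    rw [Finset.cast_card]
    refine Finset.sum_le_sum fun x hx => ?_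
    have hx' := ht (htfin.mem_toFinset.1 hx)
    exact Order.one_le_iff_ne_zero.2 ((hf x hx'.1).analyticOrderAt_ne_zero.2 hx'.2)
  rw [htfin.encard_eq_coe_toFinset_card] at hcard
  rw [hcard] at h2
  have h3 := h2.trans h1
  norm_cast at h3
  omega

/-- Rolle with multiplicities: at a zero of f the derivative has order one less, and between
neighbouring zeros of f it has a further zero where f does not vanish. -/
theorem ZerosLE.of_deriv {f : ℝ → ℝ} {a b : ℝ} {s : ℕ} (hf : AnalyticOnNhd ℝ f (Ioo a b))
    (h : ZerosLE (deriv f) (Ioo a b) s) : ZerosLE f (Ioo a b) (s + 1) := by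
  intro Z hZ
  have hfin : {x ∈ Ioo a b | deriv f x = 0}.Finite :=
    finite_of_encard_le_coe (h.encard_le hf.deriv)
  set t := hfin.toFinset with ht
  set W := Z.filter fun x => f x = 0 with hW
  have hWU : ∀ x ∈ W, x ∈ Ioo a b := fun x hx => hZ (Finset.mem_filter.1 hx).1
  have hsum : ∑ x ∈ Z, analyticOrderAt f x = ∑ x ∈ W, analyticOrderAt f x := by
    refine (Finset.sum_subset (Finset.filter_subset _ _) fun x hx hx' => ?_).symm
    exact (hf x (hZ hx)).analyticOrderAt_eq_zero.2 fun h0 => hx' (Finset.mem_filter.2 ⟨hx, h0⟩)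
  have hord : ∀ x ∈ W, analyticOrderAt f x = analyticOrderAt (deriv f) x + 1 := fun x hx => by
    rw [(hf x (hWU x hx)).analyticOrderAt_deriv_add_one, (Finset.mem_filter.1 hx).2]
    simp
  -- The new zeros of f' are counted in t \ W, so that their orders add to those at the zeros of f
  -- without overlap.
  have hcard : W.card ≤ (t \ W).card + 1 := by
    refine Finset.card_le_sdiff_of_interleaved fun x hx y hy hxy _ => ?_
    have hsub : Icc x y ⊆ Ioo a b := fun u hu =>
      ⟨(hWU x hx).1.trans_le hu.1, hu.2.trans_lt (hWU y hy).2⟩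
    obtain ⟨c, hc, hc'⟩ := exists_deriv_eq_zero hxy (hf.continuousOn.mono hsub)
      (by rw [(Finset.mem_filter.1 hx).2, (Finset.mem_filter.1 hy).2])
    exact ⟨c, hfin.mem_toFinset.2 ⟨hsub (Ioo_subset_Icc_self hc), hc'⟩, hc⟩
  have htU : ∀ x ∈ t, x ∈ Ioo a b := fun x hx => (hfin.mem_toFinset.1 hx).1
  have hle : ((t \ W).card : ℕ∞) ≤ ∑ x ∈ t \ W, analyticOrderAt (deriv f) x := by
    rw [Finset.cast_card]
    refine Finset.sum_le_sum fun x hx => ?_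
    have hx' := hfin.mem_toFinset.1 (Finset.mem_sdiff.1 hx).1
    exact Order.one_le_iff_ne_zero.2 ((hf.deriv x hx'.1).analyticOrderAt_ne_zero.2 hx'.2)
  have hfinal := h (W ∪ t \ W) fun x hx => by
    rcases Finset.mem_union.1 hx with hx | hx
    exacts [hWU x hx, htU x (Finset.mem_sdiff.1 hx).1]
  rw [Finset.sum_union Finset.disjoint_sdiff] at hfinal
  calc ∑ x ∈ Z, analyticOrderAt f x
      = ∑ x ∈ W, analyticOrderAt (deriv f) x + (W.card : ℕ∞) := by
        rw [hsum, Finset.sum_congr rfl hord, Finset.sum_add_distrib]; simp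
    _ ≤ ∑ x ∈ W, analyticOrderAt (deriv f) x +
          (∑ x ∈ t \ W, analyticOrderAt (deriv f) x + 1) := by
        gcongr
        refine le_trans ?_ (add_le_add_left hle 1)
        exact_mod_cast hcard
    _ ≤ (s : ℕ∞) + 1 := by rw [← add_assoc]; exact add_le_add_left hfinal 1
    _ = ((s + 1 : ℕ) : ℕ∞) := by norm_cast

theorem analyticOrderAt_mul_of_ne_zero {f g : ℝ → ℝ} {x : ℝ} (hg : AnalyticAt ℝ g x)
    (hgx : g x ≠ 0) (hf : AnalyticAt ℝ f x) :
    analyticOrderAt (fun t => g t * f t) x = analyticOrderAt f x := by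
  have := analyticOrderAt_mul hg hf
  rw [hg.analyticOrderAt_eq_zero.2 hgx, zero_add] at this
  exact this

/-! ### The integrals ∫ G(θ) (1 - y cos θ)^β dθ -/

/-- Measurable functions that are bounded on `[0, π]`. -/
def BddMeas (G : ℝ → ℝ) : Prop := Measurable G ∧ ∃ C, ∀ θ ∈ Icc 0 π, |G θ| ≤ C

theorem BddMeas.mul {G H : ℝ → ℝ} (hG : BddMeas G) (hH : BddMeas H) :
    BddMeas fun θ => G θ * H θ := by
  obtain ⟨hGm, C, hC⟩ := hG
  obtain ⟨hHm, D, hD⟩ := hH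
  refine ⟨hGm.mul hHm, C * D, fun θ hθ => ?_⟩
  rw [abs_mul]
  exact mul_le_mul (hC θ hθ) (hD θ hθ) (abs_nonneg _) ((abs_nonneg _).trans (hC θ hθ))

theorem bddMeas_of_continuous {G : ℝ → ℝ} (hG : Continuous G) : BddMeas G := by
  obtain ⟨C, hC⟩ := isCompact_Icc.exists_bound_of_continuousOn (s := Icc 0 π) hG.continuousOn
  exact ⟨hG.measurable, C, hC⟩

theorem BddMeas.indicator {G : ℝ → ℝ} (hG : BddMeas G) {E : Set ℝ} (hE : MeasurableSet E) :
    BddMeas (E.indicator G) := by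
  obtain ⟨hGm, C, hC⟩ := hG
  exact ⟨hGm.indicator hE, C, fun θ hθ => by
    have := norm_indicator_le_norm_self (s := E) G θ
    exact this.trans (hC θ hθ)⟩

theorem BddMeas.sum {ι : Type*} (s : Finset ι) {G : ι → ℝ → ℝ} (hG : ∀ i ∈ s, BddMeas (G i)) :
    BddMeas fun θ => ∑ i ∈ s, G i θ := by
  choose! hm C hC using hG
  refine ⟨Finset.measurable_fun_sum s hm, ∑ i ∈ s, C i, fun θ hθ => ?_⟩
  exact (Finset.abs_sum_le_sum_abs _ _).trans (Finset.sum_le_sum fun i hi => hC i hi θ hθ)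

theorem BddMeas.const_mul {G : ℝ → ℝ} (hG : BddMeas G) (c : ℝ) : BddMeas fun θ => c * G θ :=
  (bddMeas_of_continuous continuous_const).mul hG

theorem BddMeas.integrable_mul {G : ℝ → ℝ} (hG : BddMeas G) {f : ℝ → ℝ} (hf : Continuous f) :
    Integrable (fun θ => G θ * f θ) (volume.restrict (Icc 0 π)) := by
  obtain ⟨hm, C, hC⟩ := hG.mul (bddMeas_of_continuous hf)
  refine Measure.integrableOn_of_bounded (by simp) hm.aestronglyMeasurable (M := C) ?_
  exact (ae_restrict_iff' measurableSet_Icc).2 (Filter.Eventually.of_forall hC)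

theorem one_sub_mul_cos_mem_slitPlane {z : ℂ} (hz : ‖z‖ < 1) (θ : ℝ) :
    1 - z * (cos θ : ℝ) ∈ Complex.slitPlane := by
  left
  have h1 : ‖z * (cos θ : ℝ)‖ ≤ ‖z‖ := by
    rw [norm_mul, Complex.norm_real]
    exact mul_le_of_le_one_right (norm_nonneg _) (abs_cos_le_one θ)
  have h2 := (Complex.abs_re_le_norm (z * (cos θ : ℝ))).trans h1
  rw [Complex.sub_re, Complex.one_re]
  linarith [(abs_le.1 h2).2]

theorem one_sub_mul_pos {a y : ℝ} (ha : |a| ≤ 1) (hy : y ∈ Ioo (-1 : ℝ) 1) : 0 < 1 - a * y := by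
  have h : |a * y| < 1 := by
    rw [abs_mul]
    have := abs_lt.2 hy
    nlinarith [abs_nonneg a, abs_nonneg y]
  linarith [(abs_lt.1 h).2]

theorem one_sub_mul_cos_pos {y : ℝ} (hy : y ∈ Ioo (-1 : ℝ) 1) (θ : ℝ) : 0 < 1 - y * cos θ := by
  rw [mul_comm]; exact one_sub_mul_pos (abs_cos_le_one θ) hy

/-- `∫ G(θ) (1 - y cos θ)^β dθ` over `[0, π]`. -/
def powInt (β : ℝ) (G : ℝ → ℝ) (y : ℝ) : ℝ :=
  ∫ θ in Icc 0 π, G θ * (1 - y * cos θ) ^ β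

/-- The extension of `powInt` to complex arguments. -/
def powIntC (β : ℝ) (G : ℝ → ℝ) (z : ℂ) : ℂ :=
  ∫ θ in Icc 0 π, (G θ : ℂ) * (1 - z * (cos θ : ℝ)) ^ (β : ℂ)

theorem continuous_cpow {z : ℂ} (hz : ‖z‖ < 1) (w : ℂ) :
    Continuous fun θ : ℝ => (1 - z * (cos θ : ℝ)) ^ w :=
  Continuous.cpow (by fun_prop) continuous_const (one_sub_mul_cos_mem_slitPlane hz)

theorem hasDerivAt_powIntC (β : ℝ) {G : ℝ → ℝ} (hG : BddMeas G) {z : ℂ} (hz : ‖z‖ < 1) :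
    HasDerivAt (powIntC β G) (∫ θ in Icc 0 π, (G θ : ℂ) *
      ((β : ℂ) * (1 - z * (cos θ : ℝ)) ^ ((β : ℂ) - 1) * (-(cos θ : ℝ)))) z := by
  obtain ⟨r, hzr, hr⟩ := exists_between hz
  obtain ⟨hm, C, hC⟩ := hG
  have hmC : Measurable fun θ => (G θ : ℂ) := Complex.measurable_ofReal.comp hm
  have hcont : ContinuousOn (fun q : ℂ × ℝ => (β : ℂ) *
      (1 - q.1 * (cos q.2 : ℝ)) ^ ((β : ℂ) - 1) * (-(cos q.2 : ℝ)))
      (Metric.closedBall 0 r ×ˢ Icc 0 π) := by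
    refine ContinuousOn.mul (continuousOn_const.mul (ContinuousOn.cpow (by fun_prop)
      continuousOn_const fun q hq => ?_)) (by fun_prop)
    exact one_sub_mul_cos_mem_slitPlane
      ((mem_closedBall_zero_iff.1 hq.1).trans_lt hr) q.2
  obtain ⟨M, hM⟩ := ((isCompact_closedBall (0 : ℂ) r).prod
    (isCompact_Icc (a := (0 : ℝ)) (b := π))).exists_bound_of_continuousOn hcont
  have hC0 : 0 ≤ C := (abs_nonneg _).trans (hC 0 ⟨le_rfl, pi_pos.le⟩)
  refine (hasDerivAt_integral_of_dominated_loc_of_deriv_le (s := Metric.ball 0 r)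
    (bound := fun _ => C * M) (Metric.isOpen_ball.mem_nhds (by simpa using hzr))
    (F := fun z θ => (G θ : ℂ) * (1 - z * (cos θ : ℝ)) ^ (β : ℂ)) (F' := fun z θ => (G θ : ℂ) *
      ((β : ℂ) * (1 - z * (cos θ : ℝ)) ^ ((β : ℂ) - 1) * (-(cos θ : ℝ))))
    ?_ ?_ ?_ ?_ ?_ ?_).2
  · filter_upwards [Metric.isOpen_ball.mem_nhds (show z ∈ Metric.ball (0 : ℂ) 1 by simpa using hz)]
      with w hw
    exact (hmC.mul (continuous_cpow (by simpa using hw) _).measurable).aestronglyMeasurable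
  · obtain ⟨D, hD⟩ := isCompact_Icc.exists_bound_of_continuousOn (s := Icc 0 π)
      (continuous_cpow hz β).continuousOn
    refine Measure.integrableOn_of_bounded (by simp)
      (hmC.mul (continuous_cpow hz _).measurable).aestronglyMeasurable (M := C * D) ?_
    refine (ae_restrict_iff' measurableSet_Icc).2 (Filter.Eventually.of_forall fun θ hθ => ?_)
    rw [norm_mul, Complex.norm_real]
    exact mul_le_mul (hC θ hθ) (hD θ hθ) (norm_nonneg _) hC0
  · have := continuous_cpow hz ((β : ℂ) - 1)
    exact (hmC.mul (by fun_prop : Continuous _).measurable).aestronglyMeasurable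
  · refine (ae_restrict_iff' measurableSet_Icc).2 (Filter.Eventually.of_forall fun θ hθ w hw => ?_)
    rw [norm_mul, Complex.norm_real]
    exact mul_le_mul (hC θ hθ) (hM (w, θ) ⟨Metric.ball_subset_closedBall hw, hθ⟩) (norm_nonneg _) hC0
  · exact integrable_const _
  · refine Filter.Eventually.of_forall fun θ w hw => ?_
    have hw' : ‖w‖ < 1 := (by simpa using hw : ‖w‖ < r).trans hr
    refine HasDerivAt.const_mul _ ?_
    have h1 : HasDerivAt (fun w : ℂ => 1 - w * (cos θ : ℝ)) (-(cos θ : ℝ)) w := by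
      simpa using ((hasDerivAt_id w).mul_const ((cos θ : ℝ) : ℂ)).const_sub 1
    exact h1.cpow_const (one_sub_mul_cos_mem_slitPlane hw' θ)

theorem norm_ofReal_lt_one {y : ℝ} (hy : y ∈ Ioo (-1 : ℝ) 1) : ‖(y : ℂ)‖ < 1 := by
  rw [Complex.norm_real]; exact abs_lt.2 hy

theorem ofReal_one_sub_cpow {y : ℝ} (hy : y ∈ Ioo (-1 : ℝ) 1) (β θ : ℝ) :
    (1 - (y : ℂ) * (cos θ : ℝ)) ^ (β : ℂ) = (((1 - y * cos θ) ^ β : ℝ) : ℂ) := by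
  rw [Complex.ofReal_cpow (one_sub_mul_cos_pos hy θ).le]
  push_cast
  rfl

theorem powInt_eq_re {y : ℝ} (hy : y ∈ Ioo (-1 : ℝ) 1) (β : ℝ) (G : ℝ → ℝ) :
    powInt β G y = (powIntC β G y).re := by
  have : powIntC β G y = ((powInt β G y : ℝ) : ℂ) := by
    rw [powIntC, powInt, ← integral_complex_ofReal]
    refine integral_congr_ae (Filter.Eventually.of_forall fun θ => ?_)
    simp only [ofReal_one_sub_cpow hy, Complex.ofReal_mul]
  rw [this, Complex.ofReal_re]

theorem powInt_eventuallyEq {y : ℝ} (hy : y ∈ Ioo (-1 : ℝ) 1) (β : ℝ) (G : ℝ → ℝ) :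
    powInt β G =ᶠ[nhds y] fun t : ℝ => (powIntC β G t).re := by
  filter_upwards [isOpen_Ioo.mem_nhds hy] with t ht using powInt_eq_re ht β G

/-- The integral extends holomorphically to the unit disc, and near a real point of (-1, 1) it is
the real part of that extension. -/
theorem analyticOnNhd_powInt (β : ℝ) {G : ℝ → ℝ} (hG : BddMeas G) :
    AnalyticOnNhd ℝ (powInt β G) (Ioo (-1) 1) := by
  intro y hy
  have hd : DifferentiableOn ℂ (powIntC β G) (Metric.ball 0 1) := fun z hz =>
    (hasDerivAt_powIntC β hG (by simpa using hz)).differentiableAt.differentiableWithinAt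
  have h := hd.analyticOnNhd Metric.isOpen_ball (y : ℂ) (by simpa using norm_ofReal_lt_one hy)
  have h2 : AnalyticAt ℝ (fun t : ℝ => (powIntC β G t).re) y :=
    (Complex.reCLM.analyticAt _).comp
      ((h.restrictScalars (𝕜 := ℝ)).comp_of_eq (Complex.ofRealCLM.analyticAt y) rfl)
  exact h2.congr (powInt_eventuallyEq hy β G).symm

theorem hasDerivAt_powInt (β : ℝ) {G : ℝ → ℝ} (hG : BddMeas G) {y : ℝ} (hy : y ∈ Ioo (-1 : ℝ) 1) :
    HasDerivAt (powInt β G)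
      (∫ θ in Icc 0 π, G θ * (β * (1 - y * cos θ) ^ (β - 1) * (-cos θ))) y := by
  have h := (hasDerivAt_powIntC β hG (norm_ofReal_lt_one hy)).real_of_complex
  refine (h.congr_of_eventuallyEq (powInt_eventuallyEq hy β G)).congr_deriv ?_
  rw [← Complex.ofReal_re (∫ θ in Icc 0 π, G θ * (β * (1 - y * cos θ) ^ (β - 1) * (-cos θ))),
    ← integral_complex_ofReal]
  congr 1
  refine integral_congr_ae (Filter.Eventually.of_forall fun θ => ?_)
  have := ofReal_one_sub_cpow hy (β - 1) θ
  push_cast at this ⊢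
  rw [this]

theorem continuous_one_sub_rpow {y : ℝ} (hy : y ∈ Ioo (-1 : ℝ) 1) (β : ℝ) :
    Continuous fun θ => (1 - y * cos θ) ^ β :=
  Continuous.rpow_const (by fun_prop) fun θ => Or.inl (one_sub_mul_cos_pos hy θ).ne'

/-- Differentiate ((1 - y cos θ)/(1 - a y))^β under the integral; the numerator collapses, since a
(1 - y cos θ) - (1 - a y) cos θ = a - cos θ. -/
theorem hasDerivAt_rpow_mul_powInt (β : ℝ) {G : ℝ → ℝ} (hG : BddMeas G) {a y : ℝ} (ha : |a| ≤ 1)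
    (hy : y ∈ Ioo (-1 : ℝ) 1) :
    HasDerivAt (fun y => (1 - a * y) ^ (-β) * powInt β G y)
      (β * (1 - a * y) ^ (-β - 1) * powInt (β - 1) (fun θ => G θ * (a - cos θ)) y) y := by
  have hpos := one_sub_mul_pos ha hy
  have h1 : HasDerivAt (fun y => 1 - a * y) (-a) y := by
    simpa using ((hasDerivAt_id y).const_mul a).const_sub 1
  have h2 := (h1.rpow_const (p := -β) (Or.inl hpos.ne')).mul (hasDerivAt_powInt β hG hy)
  refine h2.congr_deriv ?_
  have hc := continuous_one_sub_rpow hy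
  have hsplit : (1 - a * y) ^ (-β) = (1 - a * y) ^ (-β - 1) * (1 - a * y) := by
    rw [← rpow_add_one hpos.ne']; ring_nf
  have hint : a * powInt β G y +
      (1 - a * y) * (∫ θ in Icc 0 π, G θ * ((1 - y * cos θ) ^ (β - 1) * (-cos θ))) =
      powInt (β - 1) (fun θ => G θ * (a - cos θ)) y := by
    rw [powInt, powInt, ← integral_const_mul, ← integral_const_mul, ← integral_add]
    · refine integral_congr_ae (Filter.Eventually.of_forall fun θ => ?_)
      have hp := one_sub_mul_cos_pos hy θ
      have : (1 - y * cos θ) ^ β = (1 - y * cos θ) ^ (β - 1) * (1 - y * cos θ) := by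
        rw [← rpow_add_one hp.ne']; ring_nf
      simp only [this]
      ring
    · exact (hG.integrable_mul (hc β)).const_mul a
    · have := hc (β - 1)
      exact (hG.integrable_mul (f := fun θ => (1 - y * cos θ) ^ (β - 1) * (-cos θ))
        (by fun_prop)).const_mul _
  have hI : (∫ θ in Icc 0 π, G θ * (β * (1 - y * cos θ) ^ (β - 1) * (-cos θ))) =
      β * ∫ θ in Icc 0 π, G θ * ((1 - y * cos θ) ^ (β - 1) * (-cos θ)) := by
    rw [← integral_const_mul]
    refine integral_congr_ae (Filter.Eventually.of_forall fun θ => ?_)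
    ring
  rw [hI, ← hint, hsplit]
  ring

theorem analyticAt_rpow_const {f : ℝ → ℝ} {x : ℝ} (hf : AnalyticAt ℝ f x) (hx : 0 < f x) (γ : ℝ) :
    AnalyticAt ℝ (fun t => f t ^ γ) x := by
  have h : AnalyticAt ℝ (fun t => exp (log (f t) * γ)) x :=
    ((hf.log hx).mul analyticAt_const).rexp
  refine h.congr ?_
  filter_upwards [hf.continuousAt.eventually (lt_mem_nhds hx)] with t ht
  rw [rpow_def_of_pos ht]

theorem analyticAt_one_sub_mul_rpow {a y : ℝ} (h : 0 < 1 - a * y) (γ : ℝ) :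
    AnalyticAt ℝ (fun y => (1 - a * y) ^ γ) y :=
  analyticAt_rpow_const (f := fun y => 1 - a * y)
    (analyticAt_const.sub (analyticAt_const.mul analyticAt_id)) h γ

theorem cos_ne_ae (a : ℝ) : ∀ᵐ θ ∂(volume.restrict (Icc 0 π)), cos θ ≠ a := by
  rw [ae_restrict_iff' measurableSet_Icc]
  filter_upwards [compl_mem_ae_iff.2 (measure_singleton (μ := volume) (arccos a))] with θ hθ h1 h2
  exact hθ (by rw [← h2, arccos_cos h1.1 h1.2]; rfl)

/-- The number of zeros of `∫ G(θ) (1 - y cos θ)^β dθ` is at most the number of sign changes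
of `G`. -/
theorem zerosLE_powInt (A : List ℝ) (hA : ∀ a ∈ A, |a| ≤ 1) (β : ℝ) (hβ : ∀ j : ℕ, β ≠ j)
    {G : ℝ → ℝ} (hG : BddMeas G)
    (hsign : ∀ᵐ θ ∂(volume.restrict (Icc 0 π)), 0 ≤ G θ * (A.map (· - cos θ)).prod)
    (hne : ¬ ∀ᵐ θ ∂(volume.restrict (Icc 0 π)), G θ = 0) :
    ZerosLE (powInt β G) (Ioo (-1) 1) A.length := by
  induction A generalizing β G with
  | nil =>
    intro Z hZ
    refine (Finset.sum_eq_zero fun y hy => ?_).le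
    have hy' := hZ hy
    -- With no factor left the integrand is nonnegative, so a zero of the integral would force G = 0
    -- almost everywhere.
    refine (analyticOnNhd_powInt β hG y hy').analyticOrderAt_eq_zero.2 fun h0 => hne ?_
    have hp := one_sub_mul_cos_pos hy'
    rw [powInt, integral_eq_zero_iff_of_nonneg_ae ?_
      (hG.integrable_mul (continuous_one_sub_rpow hy' β))] at h0
    · filter_upwards [h0] with θ hθ
      exact (mul_eq_zero.1 hθ).resolve_right (rpow_pos_of_pos (hp θ) β).ne'
    · filter_upwards [hsign] with θ hθ
      simp only [List.map_nil, List.prod_nil, mul_one] at hθ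
      exact mul_nonneg hθ (rpow_pos_of_pos (hp θ) β).le
  | cons a A ih =>
    have ha : |a| ≤ 1 := hA a (by simp)
    have hG' : BddMeas fun θ => G θ * (a - cos θ) :=
      hG.mul (bddMeas_of_continuous (by fun_prop))
    have hβ0 : β ≠ 0 := by simpa using hβ 0
    have h1 := ih (fun b hb => hA b (by simp [hb])) (β - 1)
      (fun j hj => hβ (j + 1) (by push_cast; linarith)) hG'
      (by
        filter_upwards [hsign] with θ hθ
        simpa [mul_assoc] using hθ)
      (fun h0 => hne (by
        filter_upwards [h0, cos_ne_ae a] with θ hθ hθa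
        exact (mul_eq_zero.1 hθ).resolve_right (sub_ne_zero.2 hθa.symm)))
    have hH : AnalyticOnNhd ℝ (fun y => (1 - a * y) ^ (-β) * powInt β G y) (Ioo (-1) 1) :=
      fun y hy => (analyticAt_one_sub_mul_rpow (one_sub_mul_pos ha hy) _).mul
        (analyticOnNhd_powInt β hG y hy)
    -- Multiplying F by (1 - a y)^(-β), and the new integral by β (1 - a y)^(-β-1), changes no order
    -- of vanishing.
    refine (ZerosLE.of_deriv hH (h1.congr_order fun y hy => ?_)).congr_order fun y hy => ?_
    · have hpos := one_sub_mul_pos ha hy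
      rw [← analyticOrderAt_mul_of_ne_zero
        (analyticAt_const.mul (analyticAt_one_sub_mul_rpow hpos (-β - 1)))
        (mul_ne_zero hβ0 (rpow_pos_of_pos hpos _).ne') (analyticOnNhd_powInt (β - 1) hG' y hy)]
      refine analyticOrderAt_congr ?_
      filter_upwards [isOpen_Ioo.mem_nhds hy] with t ht
      exact (hasDerivAt_rpow_mul_powInt β hG ha ht).deriv
    · have hpos := one_sub_mul_pos ha hy
      rw [analyticOrderAt_mul_of_ne_zero (analyticAt_one_sub_mul_rpow hpos (-β))
        (rpow_pos_of_pos hpos _).ne' (analyticOnNhd_powInt β hG y hy)]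

/-! ### Counting sign changes -/

/-- `G` changes sign at most `s` times on `(l, r)`, up to a null set. -/
def SignChangesLE (G : ℝ → ℝ) (l r : ℝ) (s : ℕ) : Prop :=
  ∃ A : List ℝ, A.length ≤ s ∧ (∀ t ∈ A, t ∈ Ioo l r) ∧ ∃ ε : ℝ, (ε = 1 ∨ ε = -1) ∧
    ∀ᵐ θ, θ ∈ Ioo l r → 0 ≤ ε * (G θ * (A.map fun t => cos t - cos θ).prod)

theorem SignChangesLE.mono {G : ℝ → ℝ} {l r : ℝ} {s s' : ℕ} (h : SignChangesLE G l r s)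
    (hs : s ≤ s') : SignChangesLE G l r s' := by
  obtain ⟨A, hA, h⟩ := h
  exact ⟨A, hA.trans hs, h⟩

theorem SignChangesLE.congr {G G' : ℝ → ℝ} {l r : ℝ} {s : ℕ} (h : SignChangesLE G l r s)
    (hG : ∀ θ ∈ Ioo l r, G' θ = G θ) : SignChangesLE G' l r s := by
  obtain ⟨A, hA, hAm, ε, hε, h⟩ := h
  refine ⟨A, hA, hAm, ε, hε, ?_⟩
  filter_upwards [h] with θ hθ hm
  rw [hG θ hm]
  exact hθ hm

theorem signChangesLE_zero {G : ℝ → ℝ} {l r : ℝ} (hG : ∀ θ ∈ Ioo l r, G θ = 0) :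
    SignChangesLE G l r 0 :=
  ⟨[], le_rfl, by simp, 1, Or.inl rfl, Filter.Eventually.of_forall fun θ hθ => by
    rw [hG θ hθ]; simp⟩

theorem prod_cos_sub_pos {l c : ℝ} (hl : 0 ≤ l) {A : List ℝ} (hA : ∀ t ∈ A, t ∈ Ioo l c) {θ : ℝ}
    (hθ : c ≤ θ) (hθπ : θ ≤ π) : 0 < (A.map fun t => cos t - cos θ).prod := by
  induction A with
  | nil => simp
  | cons t A ih =>
    have ht := hA t (by simp)
    rw [List.map_cons, List.prod_cons]
    have := cos_lt_cos_of_nonneg_of_le_pi (hl.trans ht.1.le) hθπ (ht.2.trans_le hθ)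
    exact mul_pos (by linarith) (ih fun t ht => hA t (by simp [ht]))

theorem prod_cos_sub_sign {c r : ℝ} (hr : r ≤ π) {A : List ℝ} (hA : ∀ t ∈ A, t ∈ Ioo c r) {θ : ℝ}
    (hθ : θ ≤ c) (hθ0 : 0 ≤ θ) :
    0 < (-1) ^ A.length * (A.map fun t => cos t - cos θ).prod := by
  induction A with
  | nil => simp
  | cons t A ih =>
    have ht := hA t (by simp)
    rw [List.map_cons, List.prod_cons, List.length_cons, pow_succ]
    have h1 := cos_lt_cos_of_nonneg_of_le_pi hθ0 (ht.2.le.trans hr) (hθ.trans_lt ht.1)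
    have h2 := mul_pos (show 0 < cos θ - cos t by linarith)
      (ih fun t ht => hA t (by simp [ht]))
    linarith

/-- To the left of c the product over A₂ has the constant sign (-1)^|A₂|, and to the right of c the
product over A₁ is positive. Whether the resulting signs on the two sides agree decides whether c
must be added to the list. -/
theorem SignChangesLE.glue {G : ℝ → ℝ} {l c r : ℝ} {s₁ s₂ : ℕ} (hl : 0 ≤ l) (hlc : l < c)
    (hcr : c < r) (hr : r ≤ π) (h₁ : SignChangesLE G l c s₁) (h₂ : SignChangesLE G c r s₂) :
    SignChangesLE G l r (s₁ + s₂ + 1) := by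
  obtain ⟨A₁, hA₁, hm₁, ε₁, hε₁, h₁⟩ := h₁
  obtain ⟨A₂, hA₂, hm₂, ε₂, hε₂, h₂⟩ := h₂
  have hmem : ∀ t, t ∈ A₁ ∨ t = c ∨ t ∈ A₂ → t ∈ Ioo l r := by
    rintro t (ht | rfl | ht)
    exacts [⟨(hm₁ t ht).1, (hm₁ t ht).2.trans hcr⟩, ⟨hlc, hcr⟩, ⟨hlc.trans (hm₂ t ht).1, (hm₂ t ht).2⟩]
  have hδ : (-1 : ℝ) ^ A₂.length = 1 ∨ (-1 : ℝ) ^ A₂.length = -1 := neg_one_pow_eq_or ℝ _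
  have hcases : ε₁ * (-1 : ℝ) ^ A₂.length = ε₂ ∨ ε₁ * (-1 : ℝ) ^ A₂.length = -ε₂ := by
    rcases hδ with h | h <;> rcases hε₁ with rfl | rfl <;> rcases hε₂ with rfl | rfl <;>
      rw [h] <;> norm_num
  have hleft : ∀ᵐ θ, θ ∈ Ioo l c → 0 ≤ ε₁ * (-1 : ℝ) ^ A₂.length *
      (G θ * ((A₁.map fun t => cos t - cos θ).prod * (A₂.map fun t => cos t - cos θ).prod)) := by
    filter_upwards [h₁] with θ hθ hm
    have hp := prod_cos_sub_sign hr hm₂ hm.2.le (hl.trans hm.1.le)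
    have := mul_nonneg (hθ hm) hp.le
    linarith
  have hright : ∀ᵐ θ, θ ∈ Ioo c r → 0 ≤ ε₂ *
      (G θ * ((A₁.map fun t => cos t - cos θ).prod * (A₂.map fun t => cos t - cos θ).prod)) := by
    filter_upwards [h₂] with θ hθ hm
    have hp := prod_cos_sub_pos hl hm₁ hm.1.le (hm.2.le.trans hr)
    have := mul_nonneg (hθ hm) hp.le
    linarith
  have hne : ∀ᵐ θ : ℝ, θ ≠ c := compl_mem_ae_iff.2 (measure_singleton c)
  rcases hcases with hc | hc
  · refine ⟨A₁ ++ A₂, by simp; omega, fun t ht => hmem t ?_, ε₂, hε₂, ?_⟩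
    · rcases List.mem_append.1 ht with h | h <;> simp [h]
    · filter_upwards [hleft, hright, hne] with θ h1 h2 h3 hm
      rw [List.map_append, List.prod_append]
      rcases lt_or_gt_of_ne h3 with h | h
      · rw [hc] at h1; exact h1 ⟨hm.1, h⟩
      · exact h2 ⟨h, hm.2⟩
  · refine ⟨A₁ ++ c :: A₂, by simp; omega, fun t ht => hmem t ?_, ε₂, hε₂, ?_⟩
    · rcases List.mem_append.1 ht with h | h
      · simp [h]
      · rcases List.mem_cons.1 h with h | h <;> simp [h]
    · filter_upwards [hleft, hright, hne] with θ h1 h2 h3 hm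
      rw [List.map_append, List.prod_append, List.map_cons, List.prod_cons]
      rcases lt_or_gt_of_ne h3 with h | h
      · rw [hc] at h1
        have h4 := cos_lt_cos_of_nonneg_of_le_pi (hl.trans hm.1.le) (hcr.le.trans hr) h
        have := mul_nonneg (h1 ⟨hm.1, h⟩) (show 0 ≤ cos θ - cos c by linarith)
        linarith
      · have h4 := cos_lt_cos_of_nonneg_of_le_pi (hl.trans hlc.le) (hm.2.le.trans hr) h
        have := mul_nonneg (h2 ⟨h, hm.2⟩) (show 0 ≤ cos c - cos θ by linarith)
        linarith

theorem SignChangesLE.extend_zero {G : ℝ → ℝ} {l c r : ℝ} {s : ℕ} (hcr : c < r)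
    (h : SignChangesLE G l c s) (hG : ∀ θ ∈ Ioo c r, G θ = 0) :
    SignChangesLE G l r s := by
  obtain ⟨A, hA, hm, ε, hε, h⟩ := h
  refine ⟨A, hA, fun t ht => ⟨(hm t ht).1, (hm t ht).2.trans hcr⟩, ε, hε, ?_⟩
  filter_upwards [h, compl_mem_ae_iff.2 (measure_singleton (μ := volume) c)] with θ h1 h2 h3
  rcases lt_or_gt_of_ne (show θ ≠ c from h2) with h4 | h4
  · exact h1 ⟨h3.1, h4⟩
  · rw [hG θ ⟨h4, h3.2⟩]; simp

/-- Split at a zero and induct on the number of zeros; without a zero, the intermediate value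
theorem gives a constant sign. -/
theorem signChangesLE_of_zeros {G : ℝ → ℝ} {l r : ℝ} {s : ℕ} (hl : 0 ≤ l) (hr : r ≤ π)
    (hG : ContinuousOn G (Ioo l r)) (hz : {θ ∈ Ioo l r | G θ = 0}.encard ≤ s) :
    SignChangesLE G l r s := by
  induction s using Nat.strong_induction_on generalizing l r with
  | _ s ih =>
  by_cases hex : ∃ c ∈ Ioo l r, G c = 0
  · obtain ⟨c, hc, hGc⟩ := hex
    have hsubl : Ioo l c ⊆ Ioo l r := Ioo_subset_Ioo_right hc.2.le
    have hsubr : Ioo c r ⊆ Ioo l r := Ioo_subset_Ioo_left hc.1.le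
    have hfin := finite_of_encard_le_coe hz
    have hfl : {θ ∈ Ioo l c | G θ = 0}.Finite := hfin.subset fun θ hθ => ⟨hsubl hθ.1, hθ.2⟩
    have hfr : {θ ∈ Ioo c r | G θ = 0}.Finite := hfin.subset fun θ hθ => ⟨hsubr hθ.1, hθ.2⟩
    have hcount : {θ ∈ Ioo l c | G θ = 0}.ncard + {θ ∈ Ioo c r | G θ = 0}.ncard + 1 ≤ s := by
      have hd : Disjoint {θ ∈ Ioo l c | G θ = 0} {θ ∈ Ioo c r | G θ = 0} :=
        disjoint_left.2 fun θ h1 h2 => absurd h1.1.2 h2.1.1.not_gt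
      rw [← ncard_union_eq hd hfl hfr, ← ncard_insert_of_notMem (a := c) _ (hfl.union hfr)]
      · have h1 := encard_le_encard (s := insert c ({θ ∈ Ioo l c | G θ = 0} ∪
          {θ ∈ Ioo c r | G θ = 0})) (t := {θ ∈ Ioo l r | G θ = 0}) ?_
        · rw [← ((hfl.union hfr).insert c).cast_ncard_eq] at h1
          exact_mod_cast h1.trans hz
        · rintro θ (rfl | h | h)
          exacts [⟨hc, hGc⟩, ⟨hsubl h.1, h.2⟩, ⟨hsubr h.1, h.2⟩]
      · rintro (h | h)
        exacts [lt_irrefl c h.1.2, lt_irrefl c h.1.1]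
    have h1 := ih _ (by omega) hl (hc.2.le.trans hr) (hG.mono hsubl) hfl.cast_ncard_eq.ge
    have h2 := ih _ (by omega) (hl.trans hc.1.le) hr (hG.mono hsubr) hfr.cast_ncard_eq.ge
    exact (h1.glue hl hc.1 hc.2 hr h2).mono hcount
  · push Not at hex
    refine SignChangesLE.mono ?_ (Nat.zero_le s)
    by_cases hpos : ∀ θ ∈ Ioo l r, 0 ≤ G θ
    · exact ⟨[], le_rfl, by simp, 1, Or.inl rfl, Filter.Eventually.of_forall fun θ hθ => by
        simpa using hpos θ hθ⟩
    · push Not at hpos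
      obtain ⟨x, hx, hGx⟩ := hpos
      refine ⟨[], le_rfl, by simp, -1, Or.inr rfl, Filter.Eventually.of_forall fun θ hθ => ?_⟩
      have : G θ ≤ 0 := by
        by_contra! hcon
        obtain ⟨c, hc, hGc⟩ := isPreconnected_Ioo.intermediate_value hx hθ hG
          (show (0 : ℝ) ∈ Icc (G x) (G θ) from ⟨hGx.le, hcon.le⟩)
        exact hex c hc hGc
      simpa using this

/-- Combinations of the members of `L`. -/
def comb (L : List smoothFun) (b : ℕ → ℝ) (k : ℕ) : smoothFun :=
  ∑ i ∈ Finset.range k, b i • L.getD i 0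

theorem comb_apply (L : List smoothFun) (b : ℕ → ℝ) (k : ℕ) (θ : ℝ) :
    (comb L b k).1 θ = ∑ i ∈ Finset.range k, b i * (L.getD i 0).1 θ := by
  rw [comb, smoothFun_sum_apply]; rfl

theorem IsCT.comb_zeros {L : List smoothFun} (hL : IsCT L) {k : ℕ} (hk : k ≤ L.length)
    {b : ℕ → ℝ} (hb : ∃ i < k, b i ≠ 0) :
    {θ ∈ Ioo 0 π | (comb L b k).1 θ = 0}.encard < k := by
  have h := hL k hk (fun i => b i) (fun h0 => by
    obtain ⟨i, hi, hbi⟩ := hb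
    exact hbi (congrFun h0 ⟨i, hi⟩))
  have he : comb L b k = ∑ i : Fin k, b i • L.get (Fin.castLE hk i) := by
    rw [comb, ← Fin.sum_univ_eq_sum_range (fun i => b i • L.getD i 0)]
    refine Finset.sum_congr rfl fun i _ => ?_
    rw [List.getD_eq_getElem _ _ (i.2.trans_le hk)]
    rfl
  rw [he]
  exact h

theorem comb_eq_zero {L : List smoothFun} {b : ℕ → ℝ} {k : ℕ} (hb : ∀ i < k, b i = 0) :
    comb L b k = 0 :=
  Finset.sum_eq_zero fun i hi => by rw [hb i (Finset.mem_range.1 hi), zero_smul]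

theorem IsCT.signChangesLE_comb {L : List smoothFun} (hL : IsCT L) {k : ℕ} (hk : k ≤ L.length)
    (b : ℕ → ℝ) {l r : ℝ} (hl : 0 ≤ l) (hr : r ≤ π) :
    SignChangesLE (comb L b k).1 l r (k - 1) := by
  by_cases hb : ∃ i < k, b i ≠ 0
  · have hsub : Ioo l r ⊆ Ioo 0 π := Ioo_subset_Ioo hl hr
    refine signChangesLE_of_zeros hl hr ((comb L b k).2.1.continuousOn.mono hsub) ?_
    have h1 := hL.comb_zeros hk hb
    have h2 : {θ ∈ Ioo l r | (comb L b k).1 θ = 0}.encard ≤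
        {θ ∈ Ioo 0 π | (comb L b k).1 θ = 0}.encard :=
      encard_le_encard fun θ hθ => ⟨hsub hθ.1, hθ.2⟩
    obtain ⟨i, hi, -⟩ := hb
    have h3 := h2.trans_lt h1
    have hk1 : (k : ℕ∞) = (k - 1 : ℕ) + 1 := by
      exact_mod_cast (show k = (k - 1) + 1 by omega)
    rw [hk1] at h3
    exact Order.le_of_lt_add_one h3
  · push Not at hb
    refine (signChangesLE_zero fun θ _ => ?_).mono (Nat.zero_le _)
    rw [comb_eq_zero hb]; rfl

theorem IsCT.comb_not_ae_zero {L : List smoothFun} (hL : IsCT L) {k : ℕ} (hk : k ≤ L.length)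
    {b : ℕ → ℝ} (hb : ∃ i < k, b i ≠ 0) {l r : ℝ} (hl : 0 ≤ l) (hlr : l < r) (hr : r ≤ π) :
    ¬ ∀ᵐ θ, θ ∈ Ioo l r → (comb L b k).1 θ = 0 := by
  intro h
  have hfin : {θ ∈ Ioo 0 π | (comb L b k).1 θ = 0}.Finite :=
    finite_of_encard_le_coe (hL.comb_zeros hk hb).le
  have h1 : ∀ᵐ θ : ℝ, θ ∉ {θ ∈ Ioo 0 π | (comb L b k).1 θ = 0} :=
    compl_mem_ae_iff.2 (hfin.measure_zero volume)
  have h2 : volume (Ioo l r) = 0 := by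
    rw [measure_eq_zero_iff_ae_notMem]
    filter_upwards [h, h1] with θ h3 h4 h5
    exact h4 ⟨Ioo_subset_Ioo hl hr h5, h3 h5⟩
  rw [Real.volume_Ioo, ENNReal.ofReal_eq_zero] at h2
  linarith

/-! ### Sign regularity and gluing at ϑ -/

/-- Every nontrivial combination of the first `k` members of `Gs` has at most `k - 1` sign changes
on `(0, π)` and does not vanish almost everywhere. -/
def SignRegular (Gs : List (ℝ → ℝ)) : Prop :=
  ∀ k ≤ Gs.length, ∀ b : ℕ → ℝ, (∃ i < k, b i ≠ 0) →
    SignChangesLE (fun θ => ∑ i ∈ Finset.range k, b i * Gs.getD i 0 θ) 0 π (k - 1) ∧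
    ¬ ∀ᵐ θ, θ ∈ Ioo 0 π → ∑ i ∈ Finset.range k, b i * Gs.getD i 0 θ = 0

/-- The restrictions of the members of `L` to `E`. -/
def cutList (E : Set ℝ) (L : List smoothFun) : List (ℝ → ℝ) := L.map fun f => E.indicator f.1

theorem cutList_getD_of_mem {E : Set ℝ} (L : List smoothFun) (i : ℕ) {θ : ℝ} (hθ : θ ∈ E) :
    (cutList E L).getD i 0 θ = (L.getD i 0).1 θ := by
  have h := List.getD_map (f := fun f : smoothFun => E.indicator f.1) (l := L) (n := i) (d := 0)
  have h0 : E.indicator (0 : smoothFun).1 = 0 := indicator_zero _ _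
  rw [h0] at h
  rw [cutList, h, indicator_of_mem hθ]

theorem cutList_getD_of_notMem {E : Set ℝ} (L : List smoothFun) (i : ℕ) {θ : ℝ} (hθ : θ ∉ E) :
    (cutList E L).getD i 0 θ = 0 := by
  have h := List.getD_map (f := fun f : smoothFun => E.indicator f.1) (l := L) (n := i) (d := 0)
  have h0 : E.indicator (0 : smoothFun).1 = 0 := indicator_zero _ _
  rw [h0] at h
  rw [cutList, h, indicator_of_notMem hθ]

theorem IsCT.signRegular {L : List smoothFun} (hL : IsCT L) :
    SignRegular (cutList (Icc 0 π) L) := by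
  intro k hk b hb
  rw [cutList, List.length_map] at hk
  have he : ∀ θ ∈ Ioo 0 π, ∑ i ∈ Finset.range k, b i * (cutList (Icc 0 π) L).getD i 0 θ =
      (comb L b k).1 θ := fun θ hθ => by
    rw [comb_apply]
    exact Finset.sum_congr rfl fun i _ => by
      rw [cutList_getD_of_mem L i (Ioo_subset_Icc_self hθ)]
  refine ⟨(hL.signChangesLE_comb hk b le_rfl le_rfl).congr he, fun h => ?_⟩
  refine hL.comb_not_ae_zero hk hb le_rfl pi_pos le_rfl ?_
  filter_upwards [h] with θ h1 h2
  rw [← he θ h2, h1 h2]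

theorem IsCT.signRegular_append {L₁ L₂ : List smoothFun} (h₁ : IsCT L₁) (h₂ : IsCT L₂)
    (hne : L₁ ≠ []) {ϑ : ℝ} (h0 : 0 < ϑ) (hπ : ϑ < π) :
    SignRegular (cutList (Icc 0 ϑ) L₁ ++ cutList (Icc ϑ π) L₂) := by
  intro k hk b hb
  have hN : 1 ≤ L₁.length := List.length_pos_iff.2 hne
  have hlen : (cutList (Icc 0 ϑ) L₁).length = L₁.length := List.length_map _
  have hlen₂ : (cutList (Icc ϑ π) L₂).length = L₂.length := List.length_map _
  rw [List.length_append, hlen, hlen₂] at hk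
  set G : ℝ → ℝ := fun θ => ∑ i ∈ Finset.range k, b i *
    (cutList (Icc 0 ϑ) L₁ ++ cutList (Icc ϑ π) L₂).getD i 0 θ with hG
  have hleft : ∀ θ ∈ Ioo 0 ϑ, G θ = (comb L₁ b (min k L₁.length)).1 θ := fun θ hθ => by
    have hterm : ∀ i, (cutList (Icc 0 ϑ) L₁ ++ cutList (Icc ϑ π) L₂).getD i 0 θ =
        (L₁.getD i 0).1 θ := fun i => by
      rcases Nat.lt_or_ge i L₁.length with hi | hi
      · rw [List.getD_append _ _ _ _ (by omega),
          cutList_getD_of_mem _ _ (show θ ∈ Icc _ _ from ⟨hθ.1.le, hθ.2.le⟩)]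
      · rw [List.getD_append_right _ _ _ _ (by omega),
          cutList_getD_of_notMem _ _ (fun h => hθ.2.not_ge h.1), List.getD_eq_default _ _ hi]
        rfl
    rw [comb_apply, hG]
    simp only [hterm]
    refine (Finset.sum_subset (Finset.range_subset_range.2 (min_le_left _ _))
      fun i hi hi' => ?_).symm
    rw [Finset.mem_range] at hi hi'
    rw [List.getD_eq_default _ _ (by omega)]
    exact mul_zero _
  have hright : ∀ θ ∈ Ioo ϑ π, G θ =
      (comb L₂ (fun i => b (L₁.length + i)) (k - L₁.length)).1 θ := fun θ hθ => by
    have hterm₁ : ∀ i < L₁.length,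
        (cutList (Icc 0 ϑ) L₁ ++ cutList (Icc ϑ π) L₂).getD i 0 θ = 0 := fun i hi => by
      rw [List.getD_append _ _ _ _ (by omega),
        cutList_getD_of_notMem _ _ (fun h => hθ.1.not_ge h.2)]
    have hterm₂ : ∀ i, (cutList (Icc 0 ϑ) L₁ ++ cutList (Icc ϑ π) L₂).getD (L₁.length + i) 0 θ =
        (L₂.getD i 0).1 θ := fun i => by
      rw [List.getD_append_right _ _ _ _ (by omega), hlen, Nat.add_sub_cancel_left,
        cutList_getD_of_mem _ _ (show θ ∈ Icc _ _ from ⟨hθ.1.le, hθ.2.le⟩)]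
    rw [comb_apply, hG]
    beta_reduce
    rcases Nat.lt_or_ge k L₁.length with hlt | hge
    · rw [Nat.sub_eq_zero_of_le hlt.le, Finset.range_zero, Finset.sum_empty]
      exact Finset.sum_eq_zero fun i hi => by
        rw [hterm₁ i ((Finset.mem_range.1 hi).trans hlt), mul_zero]
    · obtain ⟨m, rfl⟩ := Nat.exists_eq_add_of_le hge
      rw [Finset.sum_range_add, Finset.sum_eq_zero fun i hi => by
        rw [hterm₁ i (Finset.mem_range.1 hi), mul_zero], zero_add, Nat.add_sub_cancel_left]
      exact Finset.sum_congr rfl fun i _ => by rw [hterm₂]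
  have hs₁ := (h₁.signChangesLE_comb (min_le_right k L₁.length) b le_rfl hπ.le).congr hleft
  have hs₂ := (h₂.signChangesLE_comb (k := k - L₁.length) (by omega)
    (fun i => b (L₁.length + i)) h0.le le_rfl).congr hright
  obtain ⟨i, hi, hbi⟩ := hb
  refine ⟨?_, fun h => ?_⟩
  -- If no function on [ϑ, π] is involved, the combination vanishes there and no sign change at ϑ
  -- may be charged: the bound k - 1 is already used up on [0, ϑ].
  · rcases Nat.lt_or_ge L₁.length k with hlt | hge
    · exact (hs₁.glue le_rfl h0 hπ le_rfl hs₂).mono (by omega)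
    · rw [min_eq_left hge] at hs₁
      refine hs₁.extend_zero hπ fun θ hθ => ?_
      rw [hright θ hθ, comb_eq_zero (fun i hi => by omega)]; rfl
  · rcases Nat.lt_or_ge i L₁.length with hlt | hge
    · refine h₁.comb_not_ae_zero (min_le_right k L₁.length) ⟨i, by omega, hbi⟩ le_rfl h0 hπ.le ?_
      filter_upwards [h] with θ h3 h4
      rw [← hleft θ h4]
      exact h3 ⟨h4.1, h4.2.trans hπ⟩
    · refine h₂.comb_not_ae_zero (k := k - L₁.length) (b := fun i => b (L₁.length + i)) (by omega)
        ⟨i - L₁.length, by omega, by simpa [Nat.add_sub_cancel' hge] using hbi⟩ h0.le hπ le_rfl ?_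
      filter_upwards [h] with θ h3 h4
      rw [← hright θ h4]
      exact h3 ⟨h0.trans h4.1, h4.2⟩

/-! ### Return to the variable ρ -/

/-- `∫ G(θ) (1 + ρ - cos θ)^β dθ` over `[0, π]`. -/
def branchInt (σ β : ℝ) (G : ℝ → ℝ) (ρ : ℝ) : ℝ :=
  ∫ θ in Icc 0 π, G θ * branchPow σ β (1 + ρ - cos θ)

theorem inv_mem_Ioo {u : ℝ} (hu : 1 < |u|) : u⁻¹ ∈ Ioo (-1 : ℝ) 1 := by
  rw [mem_Ioo, ← abs_lt, abs_inv]
  exact inv_lt_one_of_one_lt₀ hu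

theorem branchPow_sub_cos (σ β : ℝ) {u : ℝ} (hu : 1 < |u|) (θ : ℝ) :
    branchPow σ β (u - cos θ) =
      (if 0 < u then 1 else σ) * |u| ^ β * (1 - u⁻¹ * cos θ) ^ β := by
  have hu0 : u ≠ 0 := by rintro rfl; simp at hu; linarith
  have hp := one_sub_mul_cos_pos (inv_mem_Ioo hu) θ
  have he : u - cos θ = u * (1 - u⁻¹ * cos θ) := by field_simp
  rw [branchPow, he]
  by_cases h : 0 < u
  · rw [if_pos (mul_pos h hp), if_pos h, mul_rpow h.le hp.le, abs_of_pos h, one_mul]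
  · have hn : u < 0 := lt_of_le_of_ne (not_lt.1 h) hu0
    rw [if_neg (mul_neg_of_neg_of_pos hn hp).not_gt, if_neg h, abs_mul, abs_of_pos hp,
      mul_rpow (abs_nonneg u) hp.le, mul_assoc]

theorem branchInt_eq (σ β : ℝ) (G : ℝ → ℝ) {ρ : ℝ} (hρ : 1 < |1 + ρ|) :
    branchInt σ β G ρ =
      (if 0 < 1 + ρ then 1 else σ) * |1 + ρ| ^ β * powInt β G (1 + ρ)⁻¹ := by
  rw [branchInt, powInt, ← integral_const_mul]
  refine integral_congr_ae (Filter.Eventually.of_forall fun θ => ?_)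
  simp only [branchPow_sub_cos σ β hρ θ]
  ring

/-- u - cos θ has the sign of u = 1 + ρ when |u| > 1, so the branch is locally constant in ρ and
uniform in θ. Hence one weight w serves all G, and σ enters only through w. -/
theorem branchInt_eventuallyEq (σ β : ℝ) (hσ : σ ≠ 0) {ρ : ℝ} (hρ : 1 < |1 + ρ|) :
    ∃ w : ℝ → ℝ, AnalyticAt ℝ w ρ ∧ w ρ ≠ 0 ∧
      ∀ G, branchInt σ β G =ᶠ[nhds ρ] fun t => w t * powInt β G (1 + t)⁻¹ := by
  have ha : AnalyticAt ℝ (fun t : ℝ => 1 + t) ρ := analyticAt_const.add analyticAt_id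
  have hcont : Continuous fun t : ℝ => 1 + t := by fun_prop
  have hlt : ∀ᶠ t in nhds ρ, 1 < |1 + t| := hcont.abs.continuousAt.eventually (lt_mem_nhds hρ)
  rcases lt_abs.1 hρ with h | h
  · refine ⟨fun t => (1 + t) ^ β, analyticAt_rpow_const ha (by linarith) β,
      (rpow_pos_of_pos (by linarith) β).ne', fun G => ?_⟩
    filter_upwards [hlt, hcont.continuousAt.eventually (lt_mem_nhds h)] with t h1 h2
    rw [branchInt_eq σ β G h1, if_pos (by linarith), one_mul, abs_of_pos (by linarith)]
  · refine ⟨fun t => σ * (-(1 + t)) ^ β,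
      analyticAt_const.mul (analyticAt_rpow_const ha.neg (by simpa using by linarith) β),
      mul_ne_zero hσ (rpow_pos_of_pos (by linarith) β).ne', fun G => ?_⟩
    filter_upwards [hlt, hcont.neg.continuousAt.eventually (lt_mem_nhds h)] with t h1 h2
    change 1 < -(1 + t) at h2
    rw [branchInt_eq σ β G h1, if_neg (by linarith), abs_of_neg (by linarith)]

theorem analyticAt_one_add_inv {ρ : ℝ} (hρ : 1 < |1 + ρ|) :
    AnalyticAt ℝ (fun t : ℝ => (1 + t)⁻¹) ρ ∧ deriv (fun t : ℝ => (1 + t)⁻¹) ρ ≠ 0 := by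
  have h0 : 1 + ρ ≠ 0 := by intro h; rw [h] at hρ; simp at hρ; linarith
  have h1 : HasDerivAt (fun t : ℝ => 1 + t) 1 ρ := (hasDerivAt_id ρ).const_add 1
  refine ⟨(analyticAt_const.add analyticAt_id : AnalyticAt ℝ (fun t : ℝ => 1 + t) ρ).inv h0, ?_⟩
  rw [(h1.fun_inv h0).deriv]
  exact div_ne_zero (by norm_num) (pow_ne_zero 2 h0)

theorem rhoDomain_subset (p : ℤ) {ρ : ℝ} (hρ : ρ ∈ rhoDomain p) : 1 < |1 + ρ| := by
  have h : ρ ∈ Iio (-2) ∪ Ioi (0 : ℝ) := by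
    rw [rhoDomain] at hρ
    split_ifs at hρ
    exacts [hρ, Or.inl hρ, Or.inr hρ]
  rw [lt_abs]
  rcases h with h | h
  · right; rw [mem_Iio] at h; linarith
  · left; rw [mem_Ioi] at h; linarith

theorem powInt_sum {ι : Type*} (β : ℝ) (s : Finset ι) (a : ι → ℝ) {G : ι → ℝ → ℝ}
    (hG : ∀ i ∈ s, BddMeas (G i)) {y : ℝ} (hy : y ∈ Ioo (-1 : ℝ) 1) :
    powInt β (fun θ => ∑ i ∈ s, a i * G i θ) y = ∑ i ∈ s, a i * powInt β (G i) y := by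
  simp only [powInt, Finset.sum_mul]
  rw [integral_finsetSum]
  · refine Finset.sum_congr rfl fun i _ => ?_
    rw [← integral_const_mul]
    exact integral_congr_ae (Filter.Eventually.of_forall fun θ => by ring)
  · intro i hi
    exact ((hG i hi).const_mul (a i)).integrable_mul (continuous_one_sub_rpow hy β)

theorem zerosLE_of_signChangesLE {β : ℝ} (hβ : ∀ j : ℕ, β ≠ j) {G : ℝ → ℝ} (hG : BddMeas G)
    {s : ℕ} (hs : SignChangesLE G 0 π s) (hne : ¬ ∀ᵐ θ, θ ∈ Ioo 0 π → G θ = 0) :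
    ZerosLE (powInt β G) (Ioo (-1) 1) s := by
  obtain ⟨A, hA, -, ε, hε, h⟩ := hs
  have hε0 : ε ≠ 0 := by rcases hε with rfl | rfl <;> norm_num
  have hmain := zerosLE_powInt (A.map cos) (by
      intro a ha
      obtain ⟨t, -, rfl⟩ := List.mem_map.1 ha
      exact abs_cos_le_one t) β hβ (hG.const_mul ε) (by
      rw [ae_restrict_iff' measurableSet_Icc]
      filter_upwards [h, compl_mem_ae_iff.2 (measure_singleton (μ := volume) (0 : ℝ)),
        compl_mem_ae_iff.2 (measure_singleton (μ := volume) π)] with θ h1 h2 h3 h4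
      have := h1 ⟨lt_of_le_of_ne h4.1 (Ne.symm h2), lt_of_le_of_ne h4.2 h3⟩
      rw [List.map_map]
      rw [← mul_assoc] at this
      exact this) (fun h0 => hne (by
      rw [ae_restrict_iff' measurableSet_Icc] at h0
      filter_upwards [h0] with θ h1 h2
      exact (mul_eq_zero.1 (h1 (Ioo_subset_Icc_self h2))).resolve_left hε0))
  rw [List.length_map] at hmain
  have hle : ZerosLE (powInt β fun θ => ε * G θ) (Ioo (-1) 1) s := fun Z hZ =>
    (hmain Z hZ).trans (by exact_mod_cast hA)
  refine hle.congr_order fun y hy => ?_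
  have he : powInt β (fun θ => ε * G θ) = fun y => ε * powInt β G y := by
    ext y
    rw [powInt, powInt, ← integral_const_mul]
    exact integral_congr_ae (Filter.Eventually.of_forall fun θ => by ring)
  rw [he]
  exact (analyticOrderAt_mul_of_ne_zero analyticAt_const hε0 (analyticOnNhd_powInt β hG y hy)).symm

theorem analyticOnNhd_branchInt (p : ℤ) {β σ : ℝ} (hσ : σ ≠ 0) {G : ℝ → ℝ} (hG : BddMeas G) :
    AnalyticOnNhd ℝ (branchInt σ β G) (rhoDomain p) := by
  intro ρ hρ
  have hρ' := rhoDomain_subset p hρ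
  obtain ⟨w, hw, -, hG'⟩ := branchInt_eventuallyEq σ β hσ hρ'
  exact (hw.mul ((analyticOnNhd_powInt β hG _ (inv_mem_Ioo hρ')).comp_of_eq
    (analyticAt_one_add_inv hρ').1 rfl)).congr (hG' G).symm

theorem analyticOrderAt_branchInt {β σ : ℝ} (hσ : σ ≠ 0) {ρ : ℝ} (hρ : 1 < |1 + ρ|) {ι : Type*}
    (s : Finset ι) (a : ι → ℝ) {G : ι → ℝ → ℝ} (hG : ∀ i ∈ s, BddMeas (G i)) :
    analyticOrderAt (fun t => ∑ i ∈ s, a i * branchInt σ β (G i) t) ρ =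
      analyticOrderAt (powInt β fun θ => ∑ i ∈ s, a i * G i θ) (1 + ρ)⁻¹ := by
  obtain ⟨w, hw, hw0, hloc⟩ := branchInt_eventuallyEq σ β hσ hρ
  obtain ⟨hinv, hinv'⟩ := analyticAt_one_add_inv hρ
  have hsum : BddMeas fun θ => ∑ i ∈ s, a i * G i θ :=
    BddMeas.sum s fun i hi => (hG i hi).const_mul (a i)
  have han := analyticOnNhd_powInt β hsum _ (inv_mem_Ioo hρ)
  have hlt : ∀ᶠ t in nhds ρ, 1 < |1 + t| :=
    (by fun_prop : Continuous fun t : ℝ => |1 + t|).continuousAt.eventually (lt_mem_nhds hρ)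
  have heq : (fun t => ∑ i ∈ s, a i * branchInt σ β (G i) t) =ᶠ[nhds ρ]
      fun t => w t * (powInt β (fun θ => ∑ i ∈ s, a i * G i θ) ∘ fun t => (1 + t)⁻¹) t := by
    filter_upwards [(Filter.eventually_all_finset s).2 fun i _ => hloc (G i), hlt] with t h1 h2
    rw [Function.comp_apply, powInt_sum β s a hG (inv_mem_Ioo h2), Finset.mul_sum]
    exact Finset.sum_congr rfl fun i hi => by rw [h1 i hi]; ring
  rw [analyticOrderAt_congr heq, analyticOrderAt_mul_of_ne_zero hw hw0
    (han.comp_of_eq hinv rfl), analyticOrderAt_comp_of_deriv_ne_zero hinv hinv']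

theorem SignRegular.isECTSystem {Gs : List (ℝ → ℝ)} (h : SignRegular Gs)
    (hG : ∀ G ∈ Gs, BddMeas G) (p : ℤ) {β σ : ℝ} (hβ : ∀ j : ℕ, β ≠ j) (hσ : σ ≠ 0) :
    IsECTSystem (Gs.map (branchInt σ β)) (rhoDomain p) := by
  refine ⟨fun g hg => ?_, fun k hk hk1 a ha Z hZ => ?_⟩
  · obtain ⟨G, hGG, rfl⟩ := List.mem_map.1 hg
    exact analyticOnNhd_branchInt p hσ (hG G hGG)
  have hk' : k ≤ Gs.length := by simpa using hk
  -- The coefficients are extended by zero so that sums run over ranges of naturals.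
  set b : ℕ → ℝ := fun i => if hi : i < k then a ⟨i, hi⟩ else 0 with hb
  have hbi : ∀ i : Fin k, b i = a i := fun i => by simp [hb]
  have hmem : ∀ i ∈ Finset.range k, BddMeas (Gs.getD i 0) := fun i hi => by
    have hi' := (Finset.mem_range.1 hi).trans_le hk'
    rw [List.getD_eq_getElem _ _ hi']
    exact hG _ (List.getElem_mem hi')
  obtain ⟨hs, hne⟩ := h k hk' b (by
    by_contra! hcon
    exact ha (funext fun i => by rw [← hbi i]; exact hcon i i.2))
  have hz := zerosLE_of_signChangesLE hβ
    (BddMeas.sum (Finset.range k) fun i hi => (hmem i hi).const_mul (b i)) hs hne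
  have hfun : (fun t => ∑ i : Fin k, a i * (Gs.map (branchInt σ β)).get (Fin.castLE hk i) t) =
      fun t => ∑ i ∈ Finset.range k, b i * branchInt σ β (Gs.getD i 0) t := by
    ext t
    rw [← Fin.sum_univ_eq_sum_range fun i => b i * branchInt σ β (Gs.getD i 0) t]
    refine Finset.sum_congr rfl fun i _ => ?_
    rw [hbi, List.getD_eq_getElem _ _ (i.2.trans_le hk')]
    simp
  rw [hfun, Finset.sum_congr rfl fun x hx =>
    analyticOrderAt_branchInt hσ (rhoDomain_subset p (hZ hx)) (Finset.range k) b hmem]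
  -- Injectivity across both half-lines lets all zeros, for ρ < -2 and ρ > 0 together, be counted
  -- once on (-1, 1).
  have hinj : Set.InjOn (fun x : ℝ => (1 + x)⁻¹) Z := fun x _ y _ hxy =>
    add_left_cancel (inv_injective hxy)
  rw [← Finset.sum_image (f := fun y => analyticOrderAt
    (powInt β fun θ => ∑ i ∈ Finset.range k, b i * Gs.getD i 0 θ) y) hinj]
  refine hz _ fun y hy => ?_
  obtain ⟨x, hx, rfl⟩ := Finset.mem_image.1 hy
  exact inv_mem_Ioo (rhoDomain_subset p (hZ hx))

/-- `res` changes f on [0, π] only at the two endpoints, a null set. -/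
theorem branchInt_indicator_res (σ β : ℝ) {E : Set ℝ} (hE : MeasurableSet E) (hEπ : E ⊆ Icc 0 π)
    {f : ℝ → ℝ} (hf : ContDiffOn ℝ ∞ f (Ioo 0 π)) (ρ : ℝ) :
    branchInt σ β (E.indicator (res f hf).1) ρ =
      ∫ θ in E, f θ * branchPow σ β (1 + ρ - cos θ) := by
  have h1 : ∀ᵐ θ ∂(volume.restrict (Icc 0 π)),
      E.indicator (res f hf).1 θ * branchPow σ β (1 + ρ - cos θ) =
        E.indicator (fun θ => f θ * branchPow σ β (1 + ρ - cos θ)) θ := by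
    rw [ae_restrict_iff' measurableSet_Icc]
    filter_upwards [compl_mem_ae_iff.2 (measure_singleton (μ := volume) (0 : ℝ)),
      compl_mem_ae_iff.2 (measure_singleton (μ := volume) π)] with θ h2 h3 h4
    by_cases hθ : θ ∈ E
    · rw [indicator_of_mem hθ, indicator_of_mem hθ,
        res_apply hf ⟨lt_of_le_of_ne h4.1 (Ne.symm h2), lt_of_le_of_ne h4.2 h3⟩]
    · rw [indicator_of_notMem hθ, indicator_of_notMem hθ, zero_mul]
  rw [branchInt, integral_congr_ae h1, setIntegral_indicator hE, inter_eq_self_of_subset_right hEπ]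

theorem map_branchInt_fullBlock (σ β : ℝ) {E : Set ℝ} (hE : MeasurableSet E) (hEπ : E ⊆ Icc 0 π)
    (r n j : ℕ) :
    (cutList E (fullBlock cosFun sinFun thetaSinFun r n j)).map (branchInt σ β) =
      fullBlock (cosInt σ β E) (sinInt σ β E) (thetaSinInt σ β E) r n j := by
  rw [cutList, List.map_map, map_fullBlock]
  congr 1 <;> ext k ρ <;> exact branchInt_indicator_res σ β hE hEπ _ ρ

theorem bddMeas_of_mem_cutList {E : Set ℝ} (hE : MeasurableSet E) {r n j : ℕ} (hrn : r ≤ n)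
    {G : ℝ → ℝ} (hG : G ∈ cutList E (fullBlock cosFun sinFun thetaSinFun r n j)) : BddMeas G := by
  obtain ⟨f, hf, rfl⟩ := List.mem_map.1 hG
  have hres : ∀ (g : ℝ → ℝ) (hg : ContDiffOn ℝ ∞ g (Ioo 0 π)), Continuous g →
      BddMeas (E.indicator (res g hg).1) := fun g hg hc =>
    ((bddMeas_of_continuous hc).indicator measurableSet_Ioo).indicator hE
  have hcos : ∀ k, BddMeas (E.indicator (cosFun k).1) := fun k => hres _ _ (by fun_prop)
  have hsin : ∀ k, BddMeas (E.indicator (sinFun k).1) := fun k => hres _ _ (by fun_prop)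
  have htheta : ∀ k, BddMeas (E.indicator (thetaSinFun k).1) := fun k => hres _ _ (by fun_prop)
  rcases mem_fullBlock _ _ _ hf with hf | ⟨k, -, -, rfl⟩
  · rcases mem_cosBlock _ _ _ hrn hf with ⟨k, -, rfl⟩ | ⟨k, -, -, rfl | rfl⟩
    exacts [hcos k, hsin k, htheta k]
  · exact hsin k

/-- The block over `[0, ϑ]` followed by a block over `[ϑ, π]` is an ECT-system. -/
theorem isECTSystem_joinAt (p : ℤ) {β σ ϑ : ℝ} (hβ : ∀ j : ℕ, β ≠ j) (hσ : σ ≠ 0)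
    (hϑ : ϑ ∈ Icc 0 π) {r₁ n₁ j₁ r₂ n₂ j₂ : ℕ} (hr₁ : r₁ ≤ n₁) (hj₁ : r₁ < j₁) (hjn₁ : j₁ ≤ n₁ + 1)
    (hr₂ : r₂ ≤ n₂) (hj₂ : r₂ < j₂) (hjn₂ : j₂ ≤ n₂ + 1) :
    IsECTSystem (joinAt ϑ
      (fullBlock (cosInt σ β (Icc 0 ϑ)) (sinInt σ β (Icc 0 ϑ)) (thetaSinInt σ β (Icc 0 ϑ)) r₁ n₁ j₁)
      (fullBlock (cosInt σ β (Icc ϑ π)) (sinInt σ β (Icc ϑ π)) (thetaSinInt σ β (Icc ϑ π)) r₂ n₂ j₂))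
      (rhoDomain p) := by
  have h₁ := isCT_fullBlock hr₁ hj₁ hjn₁
  have h₂ := isCT_fullBlock hr₂ hj₂ hjn₂
  rw [← map_branchInt_fullBlock σ β measurableSet_Icc (Icc_subset_Icc_right hϑ.2),
    ← map_branchInt_fullBlock σ β measurableSet_Icc (Icc_subset_Icc_left hϑ.1), joinAt]
  rcases hϑ.1.eq_or_lt with rfl | h0
  · rw [if_pos rfl, if_neg pi_pos.ne, List.nil_append]
    exact h₂.signRegular.isECTSystem (fun G => bddMeas_of_mem_cutList measurableSet_Icc hr₂) p hβ hσ
  rcases hϑ.2.eq_or_lt with rfl | hπ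
  · rw [if_pos rfl, if_neg pi_pos.ne', List.append_nil]
    exact h₁.signRegular.isECTSystem (fun G => bddMeas_of_mem_cutList measurableSet_Icc hr₁) p hβ hσ
  rw [if_neg h0.ne', if_neg hπ.ne, ← List.map_append]
  refine (h₁.signRegular_append h₂ (by simp [fullBlock, cosBlock, tripleBlock]) h0 hπ).isECTSystem
    (fun G hG => ?_) p hβ hσ
  rcases List.mem_append.1 hG with hG | hG
  exacts [bddMeas_of_mem_cutList measurableSet_Icc hr₁ hG,
    bddMeas_of_mem_cutList measurableSet_Icc hr₂ hG]

theorem cosList_eq_fullBlock (σ β : ℝ) (E : Set ℝ) (n : ℕ) : cosList σ β E 0 n =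
    fullBlock (cosInt σ β E) (sinInt σ β E) (thetaSinInt σ β E) 0 n (n + 1) := by
  simp [cosList, fullBlock, cosBlock, tripleBlock, List.Ico.eq_cons (Nat.succ_pos n)]

theorem tripleList_append_cosList (σ β : ℝ) (E : Set ℝ) (r n : ℕ) :
    cosInt σ β E 0 :: tripleList σ β E (r + 1) ++ cosList σ β E (r + 1) n =
      fullBlock (cosInt σ β E) (sinInt σ β E) (thetaSinInt σ β E) r n (n + 1) := by
  rw [fullBlock_succ]; rfl

end TrigECT

end

theorem proposition3p5 (p : ℤ) (hp : p ≠ 1) (β : ℝ) (hβ : ∀ j : ℕ, β ≠ (j : ℝ))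
    (σ : ℝ) (hσ : σ ≠ 0) (ϑ : ℝ) (hϑ : ϑ ∈ Set.Icc 0 Real.pi) :
    (∀ n : ℕ, 1 < n → IsECTSystem (familyOne σ β ϑ n) (rhoDomain p)) ∧
    (∀ m n : ℕ, 1 ≤ m → m < n → IsECTSystem (familyTwo σ β ϑ m n) (rhoDomain p)) ∧
    (∀ m n : ℕ, 1 ≤ m → m < n → IsECTSystem (familyThree σ β ϑ m n) (rhoDomain p)) := by
  refine ⟨fun n hn => ?_, fun m n hm hmn => ?_, fun m n hm hmn => ?_⟩
  -- With r = 0 there are no triples; j = 1 keeps all sines, and j = n + 1 keeps none.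
  · have h := TrigECT.isECTSystem_joinAt p (r₁ := 0) (n₁ := n) (j₁ := 1) (r₂ := 0) (n₂ := n)
      (j₂ := n + 1) hβ hσ hϑ (by omega) (by omega) (by omega) (by omega) (by omega) (by omega)
    rw [← TrigECT.cosList_eq_fullBlock] at h
    rw [familyOne, TrigECT.cosList_eq_fullBlock σ β (Set.Icc 0 ϑ), TrigECT.fullBlock_succ]
    exact h
  -- The triples stop at m - 1 = r, and the sines of the tail start right after, at j = r + 1.
  · obtain ⟨r, rfl⟩ : ∃ r, m = r + 1 := ⟨m - 1, by omega⟩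
    have h := TrigECT.isECTSystem_joinAt p (r₁ := r) (n₁ := n) (j₁ := r + 1) (r₂ := 0) (n₂ := n)
      (j₂ := n + 1) hβ hσ hϑ (by omega) (by omega) (by omega) (by omega) (by omega) (by omega)
    rw [← TrigECT.cosList_eq_fullBlock] at h
    exact h
  · obtain ⟨r, rfl⟩ : ∃ r, m = r + 1 := ⟨m - 1, by omega⟩
    have h := TrigECT.isECTSystem_joinAt p (r₁ := r) (n₁ := n) (j₁ := r + 1) (r₂ := r) (n₂ := n)
      (j₂ := n + 1) hβ hσ hϑ (by omega) (by omega) (by omega) (by omega) (by omega) (by omega)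
    rw [← TrigECT.tripleList_append_cosList] at h
    exact h
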